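/- Let $\mathcal{T}_h$ be a finite simplicial triangulation, by tetrahedra meeting only in common sub-simplices, of a polyhedral domain $\Omega\subset\mathbb{R}^3$ (so $\Omega$ is the interior of the union of the tetrahedra). Its Worsey--Farin refinement $\mathcal{T}_h^{WF}$ is obtained as follows. To each triangular face $F$ of $\mathcal{T}_h$ assign a face split point: if $F$ is shared by two tetrahedra, it is the point at which the segment joining their incenters meets $F$; if $F$ is a boundary face (a face of only one tetrahedron), it is the barycenter of $F$. Each $T\in\mathcal{T}_h$ is split into twelve tetrahedra, one for each face $F$ of $T$ and each edge $[a,b]$ of $F$, with vertices: the incenter of $T$, the split point of $F$, $a$, and $b$. Let $\mathcal{S}_h^I$ and $\mathcal{S}_h^B$ be the sets of interior and boundary face split points, and $\mathcal{S}_h=\mathcal{S}_h^I\cup\mathcal{S}_h^B$. An edge $e$ of $\mathcal{T}_h^{WF}$ is singular if the faces of $\mathcal{T}_h^{WF}$ meeting at $e$ fall on exactly two planes. Let $K_e^{(1)},\dots,K_e^{(n_e)}$ be the tetrahedra of $\mathcal{T}_h^{WF}$ having the singular edge $e$ as an edge, labeled so that consecutive ones share a face ($n_e=4$ with cyclic labeling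 if $e$ is an interior edge, $n_e=2$ if $e$ is a boundary edge). For a piecewise constant $q\in\mathcal{P}_0(\mathcal{T}_h^{WF})=\prod_{K\in\mathcal{T}_h^{WF}}\mathcal{P}_0(K)$ put $\theta_e(q)=\sum_{j=1}^{n_e}(-1)^{j+1}q|_{K_e^{(j)}}$, and let $$\hat Y_h^{WF}=\{q\in\mathcal{P}_0(\mathcal{T}_h^{WF}):\ \theta_e(q)=0\ \text{for every singular edge } e\}.$$ For $z\in\mathcal{S}_h$ the tetrahedra of $\mathcal{T}_h^{WF}$ with vertex $z$ can be labeled $K_z^{(1)},\dots,K_z^{(n_z)}$, with $n_z=6$ for $z\in\mathcal{S}_h^I$ and $n_z=3$ for $z\in\mathcal{S}_h^B$, such that for $z\in\mathcal{S}_h^I$ there are $T^{(1)},T^{(2)}\in\mathcal{T}_h$ with $K_z^{(1)},K_z^{(2)},K_z^{(3)}\subset T^{(1)}$ and $K_z^{(4)},K_z^{(5)},K_z^{(6)}\subset T^{(2)}$, and $K_z^{(j)}$ and $K_z^{(j+3)}$ share a face for $j=1,2,3$ (for $z\in\mathcal{S}_h^B$ the labeling is arbitrary). Fix any such labeling. Then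 $(z,j)\mapsto K_z^{(j)}$ is a bijection onto $\mathcal{T}_h^{WF}$. Let $\varphi_z^{(j)}$ be the characteristic function of $K_z^{(j)}$. For $z\in\mathcal{S}_h^I$ let $$\psi_z^{(3)}=\varphi_z^{(3)}+\varphi_z^{(1)}+\varphi_z^{(2)},\quad \psi_z^{(4)}=\varphi_z^{(4)}+\varphi_z^{(1)},\quad \psi_z^{(5)}=\varphi_z^{(5)}+\varphi_z^{(2)},\quad \psi_z^{(6)}=\varphi_z^{(6)}-\varphi_z^{(1)}-\varphi_z^{(2)},$$ and for $z\in\mathcal{S}_h^B$ let $\psi_z^{(3)}=\varphi_z^{(3)}+\varphi_z^{(1)}+\varphi_z^{(2)}$. Then the functions $\psi_z^{(j)}$ (four for each $z\in\mathcal{S}_h^I$ and one for each $z\in\mathcal{S}_h^B$) form a basis of $\hat Y_h^{WF}$. Moreover, let $\phi^{(1)},\dots,\phi^{(N)}$ be a basis of the space $\mathring V_h^{WF}$ of continuous vector fields on $\overline\Omega$ that are affine on each $K\in\mathcal{T}_h^{WF}$ and vanish on $\partial\Omega$. Let $\nu\in\mathbb{R}$, $A_{ij}=\nu\int_\Omega\nabla\phi^{(j)}:\nabla\phi^{(i)}\,dx$,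 and $\tilde B_{k,(z,j)}=-\int_\Omega(\operatorname{div}\phi^{(k)})\,\varphi_z^{(j)}\,dx$. Let $B$ be obtained from $\tilde B$ by the following column operations: for $z\in\mathcal{S}_h^I$ add columns $(z,1)$ and $(z,2)$ to column $(z,3)$, column $(z,1)$ to column $(z,4)$, column $(z,2)$ to column $(z,5)$, and subtract columns $(z,1)$ and $(z,2)$ from column $(z,6)$; for $z\in\mathcal{S}_h^B$ add columns $(z,1)$ and $(z,2)$ to column $(z,3)$; finally delete the columns $(z,1)$ and $(z,2)$ for all $z\in\mathcal{S}_h$. Then $\begin{pmatrix}A&B\\B^{T}&0\end{pmatrix}$ is the Stokes matrix of the pair $\mathring V_h^{WF}\times\hat Y_h^{WF}$ in the bases $\{\phi^{(k)}\}$ and $\{\psi_z^{(j)}\}$; that is, $B_{k,(z,j)}=-\int_\Omega(\operatorname{div}\phi^{(k)})\,\psi_z^{(j)}\,dx$. The operations before the deletion amount to a finite sequence of elementary column operations, each adding a multiple of one column to a different column, and this sequence does not depend on the matrix. -/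

import Mathlib

open Set MeasureTheory

noncomputable section

namespace WorseyFarin

open scoped Classical in
/-- The incenter of the tetrahedron with vertex set `t` (junk value `0` if `t` is not the vertex set
of a nondegenerate tetrahedron). It does not depend on the enumeration of the vertices. -/
def incenter (t : Finset (EuclideanSpace ℝ (Fin 3))) : EuclideanSpace ℝ (Fin 3) :=
  if h : ∃ S : Affine.Simplex ℝ (EuclideanSpace ℝ (Fin 3)) 3, range S.points = (t : Set _) then
    h.choose.incenter
  else 0

/-- The closed simplex with vertex set `s`. -/
def hull (s : Finset (EuclideanSpace ℝ (Fin 3))) : Set (EuclideanSpace ℝ (Fin 3)) :=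
  convexHull ℝ (s : Set (EuclideanSpace ℝ (Fin 3)))

section Mesh

variable (T : Geometry.SimplicialComplex ℝ (EuclideanSpace ℝ (Fin 3)))

/-- `T` is a (finite) simplicial triangulation by tetrahedra: there are finitely many simplices and
each of them is a vertex, an edge, a face or the whole of a tetrahedron of `T`. -/
def IsTetrahedral : Prop :=
  T.faces.Finite ∧ ∀ s ∈ T.faces, ∃ t ∈ T.faces, s ⊆ t ∧ t.card = 4

/-- The domain `Ω` triangulated by `T`: the interior of the union of the simplices of `T`. -/
def domain : Set (EuclideanSpace ℝ (Fin 3)) := interior T.space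

/-- The tetrahedra of `T`, as vertex sets. -/
def cells : Set (Finset (EuclideanSpace ℝ (Fin 3))) := {t | t ∈ T.faces ∧ t.card = 4}

/-- `z` is the split point of the interior (triangular) face `f`, i.e. `f` is shared by two
different tetrahedra of `T`, and `z` is the point at which the edge that connects the
incenters of these two tetrahedra meets `f`. -/
def IsInteriorSplitPoint (f : Finset (EuclideanSpace ℝ (Fin 3)))
    (z : EuclideanSpace ℝ (Fin 3)) : Prop :=
  f.card = 3 ∧ ∃ t₁ ∈ cells T, ∃ t₂ ∈ cells T, t₁ ≠ t₂ ∧ f ⊆ t₁ ∧ f ⊆ t₂ ∧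
    z ∈ segment ℝ (incenter t₁) (incenter t₂) ∧ z ∈ hull f

/-- `z` is the split point of the boundary (triangular) face `f`, i.e. `f` is a face of exactly one
tetrahedron of `T`, and `z` is the barycenter of `f`. -/
def IsBoundarySplitPoint (f : Finset (EuclideanSpace ℝ (Fin 3)))
    (z : EuclideanSpace ℝ (Fin 3)) : Prop :=
  f.card = 3 ∧ (∃! t, t ∈ cells T ∧ f ⊆ t) ∧ z = f.centroid ℝ id

/-- The interior face split points. -/
def interiorSplitPoints : Set (EuclideanSpace ℝ (Fin 3)) := {z | ∃ f, IsInteriorSplitPoint T f z}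

/-- The boundary face split points. -/
def boundarySplitPoints : Set (EuclideanSpace ℝ (Fin 3)) := {z | ∃ f, IsBoundarySplitPoint T f z}

open scoped Classical in
/-- The tetrahedra of the Worsey-Farin triangulation, as vertex sets: for every tetrahedron `t` of
`T`, every triangular face `f` of `t` and every edge `e` of `f` there is the sub-tetrahedron whose
vertices are the incenter of `t`, the split point `z` of `f`, and the two vertices of `e`. -/
def wfCells : Set (Finset (EuclideanSpace ℝ (Fin 3))) :=
  {K | ∃ t ∈ cells T, ∃ f ⊆ t, ∃ z, (IsInteriorSplitPoint T f z ∨ IsBoundarySplitPoint T f z) ∧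
    ∃ e ⊆ f, e.card = 2 ∧ K = insert (incenter t) (insert z e)}

/-- The edges of the Worsey-Farin triangulation. -/
def wfEdges : Set (Finset (EuclideanSpace ℝ (Fin 3))) :=
  {e | e.card = 2 ∧ ∃ K ∈ wfCells T, e ⊆ K}

/-- The triangular faces of the Worsey-Farin triangulation. -/
def wfFaces : Set (Finset (EuclideanSpace ℝ (Fin 3))) :=
  {f | f.card = 3 ∧ ∃ K ∈ wfCells T, f ⊆ K}

/-- The singular edges: the faces meeting at the edge fall on exactly two planes. -/
def singularEdges : Set (Finset (EuclideanSpace ℝ (Fin 3))) :=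
  {e | e ∈ wfEdges T ∧
    {P : AffineSubspace ℝ (EuclideanSpace ℝ (Fin 3)) |
      ∃ f ∈ wfFaces T, e ⊆ f ∧ P = affineSpan ℝ (f : Set (EuclideanSpace ℝ (Fin 3)))}.ncard = 2}

/-- A boundary edge is an edge of a boundary face, and a boundary face is a face of exactly one
tetrahedron. -/
def IsBoundaryEdge (e : Finset (EuclideanSpace ℝ (Fin 3))) : Prop :=
  e ∈ wfEdges T ∧ ∃ f ∈ wfFaces T, e ⊆ f ∧ ∃! K, K ∈ wfCells T ∧ f ⊆ K

open scoped Classical in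
/-- Two tetrahedra share a common (triangular) face. -/
def ShareFace (K L : Finset (EuclideanSpace ℝ (Fin 3))) : Prop := (K ∩ L).card = 3

/-- `K` lists, without repetition, the tetrahedra that have `e` as an edge, in such a way
that consecutive ones share a face; the list is cyclic, as befits an interior edge. -/
def IsInteriorEdgeLabeling (e : Finset (EuclideanSpace ℝ (Fin 3))) (K : Fin 4 → wfCells T) :
    Prop :=
  Function.Injective K ∧ range K = {L | e ⊆ L.1} ∧ ∀ j : Fin 4, ShareFace (K j).1 (K (j + 1)).1

/-- The same for a boundary edge, where there are two tetrahedra. -/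
def IsBoundaryEdgeLabeling (e : Finset (EuclideanSpace ℝ (Fin 3))) (K : Fin 2 → wfCells T) :
    Prop :=
  Function.Injective K ∧ range K = {L | e ⊆ L.1} ∧ ShareFace (K 0).1 (K 1).1

/-- Piecewise constants on the Worsey-Farin triangulation, as the product of the spaces of constants
on the tetrahedra. -/
abbrev P0 : Type := wfCells T → ℝ

/-- The space of piecewise constants `q` with `θ_e(q) = 0` for every singular edge `e`, where
`θ_e(q)` is the alternating sum of the values of `q` on the tetrahedra around `e`. (The vanishing of
this sum does not depend on the labeling of these tetrahedra.) -/
def pressureSpace : Submodule ℝ (P0 T) where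
  carrier := {q | ∀ e ∈ singularEdges T,
    (¬ IsBoundaryEdge T e → ∀ K : Fin 4 → wfCells T, IsInteriorEdgeLabeling T e K →
      q (K 0) - q (K 1) + q (K 2) - q (K 3) = 0) ∧
    (IsBoundaryEdge T e → ∀ K : Fin 2 → wfCells T, IsBoundaryEdgeLabeling T e K →
      q (K 0) - q (K 1) = 0)}
  zero_mem' := by
    intro e _
    simp
  add_mem' := by
    intro p q hp hq e he
    refine ⟨fun hb K hK => ?_, fun hb K hK => ?_⟩
    · have h₁ := (hp e he).1 hb K hK
      have h₂ := (hq e he).1 hb K hK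
      simp only [Pi.add_apply]
      linarith
    · have h₁ := (hp e he).2 hb K hK
      have h₂ := (hq e he).2 hb K hK
      simp only [Pi.add_apply]
      linarith
  smul_mem' := by
    intro c q hq e he
    refine ⟨fun hb K hK => ?_, fun hb K hK => ?_⟩
    · have h := (hq e he).1 hb K hK
      simp only [Pi.smul_apply, smul_eq_mul]
      linear_combination c * h
    · have h := (hq e he).2 hb K hK
      simp only [Pi.smul_apply, smul_eq_mul]
      linear_combination c * h

/-- An admissible labeling of the tetrahedra around the face split points. `inner z` enumerates
the six tetrahedra with vertex `z`, for `z` an interior split point: the first three lie in one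
tetrahedron of `T`, the last three in one tetrahedron of `T`, and the `j`-th and the
`(j + 3)`-rd share a face. `outer z` enumerates (arbitrarily) the three tetrahedra with
vertex `z`, for `z` a boundary split point. -/
structure Labeling where
  inner : interiorSplitPoints T → Fin 6 → wfCells T
  inner_injective : ∀ z, Function.Injective (inner z)
  range_inner : ∀ z, range (inner z) = {K | z.1 ∈ K.1}
  inner_subset : ∀ z, ∃ t₁ ∈ cells T, ∃ t₂ ∈ cells T, ∀ j : Fin 3,
    hull (inner z (Fin.castAdd 3 j)).1 ⊆ hull t₁ ∧ hull (inner z (Fin.natAdd 3 j)).1 ⊆ hull t₂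
  inner_shareFace : ∀ z, ∀ j : Fin 3,
    ShareFace (inner z (Fin.castAdd 3 j)).1 (inner z (Fin.natAdd 3 j)).1
  outer : boundarySplitPoints T → Fin 3 → wfCells T
  outer_injective : ∀ z, Function.Injective (outer z)
  range_outer : ∀ z, range (outer z) = {K | z.1 ∈ K.1}

/-- The labels `(z, j)`, `j = 1, …, n_z` (counted from `0` here), with `n_z = 6` at interior
and `n_z = 3` at boundary split points. -/
abbrev Label : Type := (interiorSplitPoints T × Fin 6) ⊕ (boundarySplitPoints T × Fin 3)

/-- The labels of the basis functions: four at each interior split point, namely `j = 3, 4, 5, 6`,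
and one at each boundary split point, namely `j = 3`. -/
abbrev BasisLabel : Type := (interiorSplitPoints T × Fin 4) ⊕ boundarySplitPoints T

variable {T}

/-- The inclusion of the labels of the basis functions into all labels. -/
def BasisLabel.toLabel : BasisLabel T → Label T
  | .inl (z, j) => .inl (z, Fin.natAdd 2 j)
  | .inr z => .inr (z, 2)

/-- The tetrahedron with a given label. -/
def Labeling.cell (lab : Labeling T) : Label T → wfCells T
  | .inl (z, j) => lab.inner z j
  | .inr (z, j) => lab.outer z j

open scoped Classical in
/-- The characteristic function of the tetrahedron with a given label. -/
def Labeling.phi (lab : Labeling T) (c : Label T) : P0 T := Pi.single (lab.cell c) 1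

/-- The combinations `ψ_z^{(j)}` of the characteristic functions. -/
def Labeling.psi (lab : Labeling T) : BasisLabel T → P0 T
  | .inl (z, j) =>
      ![lab.phi (.inl (z, 2)) + lab.phi (.inl (z, 0)) + lab.phi (.inl (z, 1)),
        lab.phi (.inl (z, 3)) + lab.phi (.inl (z, 0)),
        lab.phi (.inl (z, 4)) + lab.phi (.inl (z, 1)),
        lab.phi (.inl (z, 5)) - lab.phi (.inl (z, 0)) - lab.phi (.inl (z, 1))] j
  | .inr z => lab.phi (.inr (z, 2)) + lab.phi (.inr (z, 0)) + lab.phi (.inr (z, 1))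

variable (T)

/-- A piecewise constant as a function on the domain (defined up to the null set of the boundaries
of the tetrahedra, where the value `0` is used). -/
def P0.toFun (q : P0 T) (x : EuclideanSpace ℝ (Fin 3)) : ℝ :=
  ∑ᶠ K : wfCells T, (interior (hull K.1)).indicator (fun _ => q K) x

/-- The velocity space: continuous piecewise linear vector fields on the Worsey-Farin triangulation
that vanish on the boundary of the domain, extended by zero to the whole space. -/
def velocitySpace : Submodule ℝ (EuclideanSpace ℝ (Fin 3) → EuclideanSpace ℝ (Fin 3)) where
  carrier := {v | Continuous v ∧ (∀ x ∉ domain T, v x = 0) ∧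
    ∀ K ∈ wfCells T, ∃ A : EuclideanSpace ℝ (Fin 3) →ᵃ[ℝ] EuclideanSpace ℝ (Fin 3),
      ∀ x ∈ hull K, v x = A x}
  zero_mem' := ⟨continuous_zero, fun _ _ => rfl, fun _ _ => ⟨0, fun _ _ => rfl⟩⟩
  add_mem' := by
    rintro v w ⟨hv, hv0, hvA⟩ ⟨hw, hw0, hwA⟩
    refine ⟨hv.add hw, fun x hx => by simp [hv0 x hx, hw0 x hx], fun K hK => ?_⟩
    obtain ⟨A, hA⟩ := hvA K hK
    obtain ⟨B, hB⟩ := hwA K hK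
    exact ⟨A + B, fun x hx => by simp [hA x hx, hB x hx]⟩
  smul_mem' := by
    rintro c v ⟨hv, hv0, hvA⟩
    refine ⟨hv.const_smul c, fun x hx => by simp [hv0 x hx], fun K hK => ?_⟩
    obtain ⟨A, hA⟩ := hvA K hK
    exact ⟨c • A, fun x hx => by simp [hA x hx]⟩

/-- The divergence of a vector field. (For a piecewise linear field it is the weak divergence; the
boundaries of the tetrahedra are a null set.) -/
def divergence (v : EuclideanSpace ℝ (Fin 3) → EuclideanSpace ℝ (Fin 3))
    (x : EuclideanSpace ℝ (Fin 3)) : ℝ :=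
  ∑ a : Fin 3, fderiv ℝ v x (EuclideanSpace.single a 1) a

/-- The Frobenius product `∇v : ∇w`. -/
def gradProd (v w : EuclideanSpace ℝ (Fin 3) → EuclideanSpace ℝ (Fin 3))
    (x : EuclideanSpace ℝ (Fin 3)) : ℝ :=
  ∑ a : Fin 3, ∑ b : Fin 3,
    fderiv ℝ v x (EuclideanSpace.single a 1) b * fderiv ℝ w x (EuclideanSpace.single a 1) b

/-- The matrix `A` with entries `ν ∫_Ω ∇v_j : ∇v_i`. -/
def velocityMatrix (ν : ℝ) {N : ℕ}
    (v : Fin N → EuclideanSpace ℝ (Fin 3) → EuclideanSpace ℝ (Fin 3)) :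
    Matrix (Fin N) (Fin N) ℝ :=
  Matrix.of fun i j => ν * ∫ x in domain T, gradProd (v j) (v i) x

/-- The matrix with entries `-∫_Ω (div v_k) q_i`. -/
def divMatrix {N : ℕ} {ι : Type} (v : Fin N → EuclideanSpace ℝ (Fin 3) → EuclideanSpace ℝ (Fin 3))
    (q : ι → P0 T) : Matrix (Fin N) ι ℝ :=
  Matrix.of fun k i => -∫ x in domain T, divergence (v k) x * P0.toFun T (q i) x

/-- The saddle point matrix of the Stokes problem with viscosity `ν` for a family of velocities and
a family of pressures. -/
def stokesMatrix (ν : ℝ) {N : ℕ} {ι : Type}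
    (v : Fin N → EuclideanSpace ℝ (Fin 3) → EuclideanSpace ℝ (Fin 3)) (q : ι → P0 T) :
    Matrix (Fin N ⊕ ι) (Fin N ⊕ ι) ℝ :=
  Matrix.fromBlocks (velocityMatrix T ν v) (divMatrix T v q) (divMatrix T v q).transpose 0

variable {T}

/-- The column operations of the algorithm: at each interior split point `z`, add columns
`(z,1), (z,2)` to column `(z,3)`, column `(z,1)` to column `(z,4)`, column `(z,2)` to column `(z,5)`,
and subtract columns `(z,1), (z,2)` from column `(z,6)`; at each boundary split point `z`, add columns
`(z,1), (z,2)` to column `(z,3)`. -/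
def columnOps {N : ℕ} (B : Matrix (Fin N) (Label T) ℝ) : Matrix (Fin N) (Label T) ℝ :=
  Matrix.of fun k c => match c with
    | .inl (z, j) =>
        ![B k (.inl (z, 0)),
          B k (.inl (z, 1)),
          B k (.inl (z, 2)) + B k (.inl (z, 0)) + B k (.inl (z, 1)),
          B k (.inl (z, 3)) + B k (.inl (z, 0)),
          B k (.inl (z, 4)) + B k (.inl (z, 1)),
          B k (.inl (z, 5)) - B k (.inl (z, 0)) - B k (.inl (z, 1))] j
    | .inr (z, j) =>
        ![B k (.inr (z, 0)),
          B k (.inr (z, 1)),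
          B k (.inr (z, 2)) + B k (.inr (z, 0)) + B k (.inr (z, 1))] j

/-- Deletion of the columns `(z,1)` and `(z,2)` for all split points `z`. -/
def deleteColumns {N : ℕ} (B : Matrix (Fin N) (Label T) ℝ) : Matrix (Fin N) (BasisLabel T) ℝ :=
  B.submatrix id BasisLabel.toLabel

open scoped Classical in
/-- The elementary column operation that adds `c` times column `i` to column `j`. -/
def addColumn {N : ℕ} {ι : Type} (B : Matrix (Fin N) ι ℝ) (i j : ι) (c : ℝ) :
    Matrix (Fin N) ι ℝ :=
  B.updateCol j fun k => B k j + c * B k i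

end Mesh

end WorseyFarin

end

/-!
The theorem rests on three facts.

*The incenters and split points are in general position.* The incenter of a tetrahedron lies inside
it. The segment between the incenters of two adjacent tetrahedra meets the relative interior of
their common face `f`: the tetrahedra lie on opposite sides of `f` (`coord_neg_of_common_face`), so
the segment crosses the plane of `f`, and the crossing point is a convex combination of the
orthogonal projections of the incenters, which are the points where the inspheres touch `f`
(`exists_segment_inter_face`). Every vertex of the refinement therefore lies in one open simplex of
`T`, of dimension `3`, `2` or `0`, according to whether it is an incenter, a split point or a vertex
of `T`. As open simplices are disjoint, a tetrahedron of the refinement is the same thing as a flag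
`e ⊆ f ⊆ t` of an edge, a face and a tetrahedron of `T` (`Flag`, `Flag.tet_eq_iff`), and incidences
in the refinement can be read off from the flags (`Flag.card_verts_inter`).

*The singular edges are the segments from a split point `z` of a face `f` to the vertices of `f`.*
At such an edge, one plane is that of `f`, and the other one contains the incenters on both sides
since they are collinear with `z` (`Flag.pair_mem_singularEdges`). At every other edge there are
three planes, as the four vertices of a tetrahedron of the refinement are not coplanar
(`Flag.affineSpan_ne`, `exists_eq_of_mem_singularEdges`).

*The constraints decouple.* At a vertex of an interior face, the constraint says that the jumps of
`q` across the face at the two edges through the vertex agree; at a vertex of a boundary face, it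
says that the two values agree. Any two edges of a triangle have a common vertex, so the jumps at
all three edges (or all three values) agree (`Labeling.mem_pressureSpace_iff`). Hence, the values at
the labels `3, 4, 5, 6` of an interior and at the label `3` of a boundary split point determine `q`,
and the functions `ψ` have the unit vectors as their values there (`Labeling.exists_basis`).

The assertion on the matrices is the linearity of the integral in the pressure; the divergence of a
velocity is constant on each tetrahedron, so that all integrals exist. The column operations only
use the first two columns at each split point, which they do not change, and can therefore be
carried out one after the other.
-/

noncomputable section

namespace WorseyFarin

local notation "𝔼" => EuclideanSpace ℝ (Fin 3)

/-! ### Open simplices -/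

section OpenSimplex

variable {V : Type*} [AddCommGroup V] [Module ℝ V]

/-- `x` lies in the relative interior of the simplex with vertex set `s`: it is a convex combination
of the points of `s` with positive weights only. -/
def InOpenSimplex (s : Finset V) (x : V) : Prop :=
  ∃ w : V → ℝ, (∀ a ∈ s, 0 < w a) ∧ ∑ a ∈ s, w a = 1 ∧ ∑ a ∈ s, w a • a = x

theorem InOpenSimplex.mem_convexHull {s : Finset V} {x : V} (h : InOpenSimplex s x) :
    x ∈ convexHull ℝ (s : Set V) := by
  obtain ⟨w, hw, hw1, hx⟩ := h
  exact Finset.mem_convexHull'.2 ⟨w, fun a ha => (hw a ha).le, hw1, hx⟩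

theorem inOpenSimplex_singleton (a : V) : InOpenSimplex {a} a :=
  ⟨fun _ => 1, by simp, by simp, by simp⟩

theorem inOpenSimplex_pair [DecidableEq V] {p q : V} (hpq : p ≠ q) {c d : ℝ} (hc : 0 < c)
    (hd : 0 < d) (hcd : c + d = 1) : InOpenSimplex {p, q} (c • p + d • q) := by
  refine ⟨fun a => if a = p then c else d, fun a _ => ?_, ?_, ?_⟩
  · dsimp only
    split_ifs <;> assumption
  · simp [Finset.sum_pair hpq, hpq.symm, hcd]
  · simp [Finset.sum_pair hpq, hpq.symm]

theorem InOpenSimplex.convexComb {s : Finset V} {x y : V} (hx : InOpenSimplex s x)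
    (hy : InOpenSimplex s y) {c d : ℝ} (hc : 0 < c) (hd : 0 < d) (hcd : c + d = 1) :
    InOpenSimplex s (c • x + d • y) := by
  obtain ⟨w, hw, hw1, rfl⟩ := hx
  obtain ⟨u, hu, hu1, rfl⟩ := hy
  refine ⟨fun a => c * w a + d * u a, fun a ha => ?_, ?_, ?_⟩
  · have := mul_pos hc (hw a ha)
    have := mul_pos hd (hu a ha)
    positivity
  · rw [Finset.sum_add_distrib, ← Finset.mul_sum, ← Finset.mul_sum, hw1, hu1]
    linarith
  · simp only [add_smul, mul_smul, Finset.sum_add_distrib, Finset.smul_sum]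

theorem affineMap_sum_smul {W : Type*} [AddCommGroup W] [Module ℝ W] (g : V →ᵃ[ℝ] W)
    {s : Finset V} {w : V → ℝ} (hw : ∑ a ∈ s, w a = 1) :
    g (∑ a ∈ s, w a • a) = ∑ a ∈ s, w a • g a := by
  have h : ∀ v, g v = g.linear v + g 0 := fun v => congrFun g.decomp v
  have h' : ∀ a, w a • g a = w a • g.linear a + w a • g 0 := fun a => by rw [h a, smul_add]
  rw [h, Finset.sum_congr rfl fun a _ => h' a, Finset.sum_add_distrib, ← Finset.sum_smul, hw,
    one_smul, map_sum]
  simp only [map_smul]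

/-- An affine subspace through a point of an open simplex and through all vertices but one contains
the last vertex, too. -/
theorem InOpenSimplex.exchange {s : Finset V} {x p : V} (h : InOpenSimplex s x) (hp : p ∈ s)
    {S : AffineSubspace ℝ V} (hx : x ∈ S) (hS : ∀ a ∈ s, a ≠ p → a ∈ S) : p ∈ S := by
  classical
  obtain ⟨w, hw, hw1, hwx⟩ := h
  have h1 : ∑ a ∈ s, w a • (x - a) = 0 := by
    simp only [smul_sub, Finset.sum_sub_distrib, ← Finset.sum_smul, hw1, hwx, one_smul, sub_self]
  rw [← Finset.add_sum_erase s _ hp] at h1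
  have h2 : p = (w p)⁻¹ • (∑ a ∈ s.erase p, w a • (x - a)) + x := by
    have h3 : ∑ a ∈ s.erase p, w a • (x - a) = w p • (p - x) := by
      rw [eq_comm, ← sub_eq_zero, ← neg_eq_zero, ← h1]
      module
    rw [h3, inv_smul_smul₀ (hw p hp).ne']
    abel
  rw [h2]
  refine AffineSubspace.vadd_mem_of_mem_direction (S.direction.smul_mem _ ?_) hx
  refine S.direction.sum_mem fun a ha => S.direction.smul_mem _ ?_
  exact S.vsub_mem_direction hx (hS a (Finset.mem_of_mem_erase ha) (Finset.ne_of_mem_erase ha))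

theorem InOpenSimplex.mem_affineSpan {s : Finset V} {x : V} (h : InOpenSimplex s x) :
    x ∈ affineSpan ℝ (s : Set V) :=
  convexHull_subset_affineSpan _ h.mem_convexHull

/-- If a closed simplex of a simplicial complex meets an open one, then the latter is one of its
faces. -/
theorem InOpenSimplex.subset_of_mem_convexHull {T : Geometry.SimplicialComplex ℝ V}
    {s t : Finset V} (hs : s ∈ T.faces) (ht : t ∈ T.faces) {x : V} (hx : InOpenSimplex s x)
    (hxt : x ∈ convexHull ℝ (t : Set V)) : s ⊆ t := by
  classical
  have h := T.inter_subset_convexHull hs ht ⟨hx.mem_convexHull, hxt⟩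
  rw [← Finset.coe_inter] at h
  obtain ⟨u, -, hu1, hux⟩ := Finset.mem_convexHull'.1 h
  obtain ⟨w, hw, hw1, hwx⟩ := hx
  have key := (T.indep hs).eq_of_sum_eq_sum_subtype (w₁ := w)
    (w₂ := fun a => if a ∈ t then u a else 0)
    (by rw [hw1, ← hu1, Finset.sum_ite_mem])
    (by
      simp only [ite_smul, zero_smul]
      rw [hwx, ← hux, Finset.sum_ite_mem])
  intro a ha
  by_contra hat
  have := key a ha
  have := hw a ha
  simp_all

/-- The open simplices of a simplicial complex are disjoint. -/
theorem InOpenSimplex.unique {T : Geometry.SimplicialComplex ℝ V}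
    {s t : Finset V} (hs : s ∈ T.faces) (ht : t ∈ T.faces) {x : V} (hx : InOpenSimplex s x)
    (hxt : InOpenSimplex t x) : s = t :=
  (hx.subset_of_mem_convexHull hs ht hxt.mem_convexHull).antisymm
    (hxt.subset_of_mem_convexHull ht hs hx.mem_convexHull)

end OpenSimplex

theorem inOpenSimplex_of_mem_interior {V : Type*} [NormedAddCommGroup V] [InnerProductSpace ℝ V]
    {n : ℕ} (S : Affine.Simplex ℝ V n) {s : Finset V}
    (hS : range S.points = (s : Set V)) {x : V} (hx : x ∈ S.interior) : InOpenSimplex s x := by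
  classical
  obtain ⟨w, hw1, hw, rfl⟩ := hx
  have hinj := S.independent.injective
  have hs : s = Finset.univ.image S.points := by
    apply Finset.coe_injective
    simp [← hS]
  have hl := Function.leftInverse_invFun hinj
  refine ⟨fun a => w (Function.invFun S.points a), fun a ha => (hw _).1, ?_, ?_⟩
  · rw [hs, Finset.sum_image (fun a _ b _ h => hinj h)]
    simp only [hl _, hw1]
  · rw [hs, Finset.sum_image (fun a _ b _ h => hinj h),
      Finset.affineCombination_eq_linear_combination _ _ _ hw1]
    simp only [hl _]

/-! ### Tetrahedra in three-space and their incenters -/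

theorem affineSpan_eq_top_of_card {t : Finset 𝔼} (ht : AffineIndependent ℝ ((↑) : t → 𝔼))
    (hc : t.card = 4) : affineSpan ℝ (t : Set 𝔼) = ⊤ := by
  have h := (ht.affineSpan_eq_top_iff_card_eq_finrank_add_one).2 (by simp [hc])
  simpa using h

theorem exists_weights {t : Finset 𝔼} (ht : AffineIndependent ℝ ((↑) : t → 𝔼))
    (hc : t.card = 4) (x : 𝔼) : ∃ w : 𝔼 → ℝ, ∑ a ∈ t, w a = 1 ∧ ∑ a ∈ t, w a • a = x := by
  classical
  have hx : x ∈ affineSpan ℝ (range ((↑) : t → 𝔼)) := by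
    have := affineSpan_eq_top_of_card ht hc
    simp only [Subtype.range_coe_subtype]
    have h2 : {x | x ∈ t} = (t : Set 𝔼) := rfl
    rw [h2, this]
    trivial
  obtain ⟨w, hw1, hw⟩ := eq_affineCombination_of_mem_affineSpan_of_fintype hx
  rw [Finset.affineCombination_eq_linear_combination _ _ _ hw1] at hw
  refine ⟨fun a => if h : a ∈ t then w ⟨a, h⟩ else 0, ?_, ?_⟩
  · rw [← Finset.sum_coe_sort, ← hw1]
    simp
  · rw [← Finset.sum_coe_sort, hw]
    simp

/-- The barycentric coordinate that belongs to the vertex `v` of a tetrahedron. -/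
theorem exists_coord {f : Finset 𝔼} {v : 𝔼} (hv : v ∉ f) [DecidableEq 𝔼]
    (ht : AffineIndependent ℝ ((↑) : ↥(insert v f) → 𝔼)) (hc : (insert v f).card = 4) :
    ∃ g : 𝔼 →ᵃ[ℝ] ℝ, (∀ a ∈ f, g a = 0) ∧ g v = 1 := by
  let b : AffineBasis ↥(insert v f) ℝ 𝔼 :=
    ⟨(↑), ht, by rw [Subtype.range_coe]; exact affineSpan_eq_top_of_card ht hc⟩
  refine ⟨b.coord ⟨v, Finset.mem_insert_self _ _⟩, fun a ha => ?_, ?_⟩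
  · have := b.coord_apply_ne (i := ⟨v, Finset.mem_insert_self _ _⟩)
      (j := ⟨a, Finset.mem_insert_of_mem ha⟩) (by
        intro h
        apply hv
        have := congrArg Subtype.val h
        simp only at this
        rwa [this])
    exact this
  · exact b.coord_apply_eq _

theorem mem_affineSpan_of_coord_eq_zero {f : Finset 𝔼} {v : 𝔼} (hv : v ∉ f) [DecidableEq 𝔼]
    (ht : AffineIndependent ℝ ((↑) : ↥(insert v f) → 𝔼)) (hc : (insert v f).card = 4)
    {g : 𝔼 →ᵃ[ℝ] ℝ} (hg : ∀ a ∈ f, g a = 0) (hgv : g v ≠ 0) {x : 𝔼} (hx : g x = 0) :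
    x ∈ affineSpan ℝ (f : Set 𝔼) := by
  obtain ⟨w, hw1, rfl⟩ := exists_weights ht hc x
  rw [affineMap_sum_smul g hw1, Finset.sum_insert hv,
    Finset.sum_eq_zero (fun a ha => by rw [hg a ha, smul_zero])] at hx
  have hwv : w v = 0 := by simpa [hgv] using hx
  rw [Finset.sum_insert hv, hwv, zero_add] at hw1
  rw [Finset.sum_insert hv, hwv, zero_smul, zero_add]
  have h := Finset.affineCombination_eq_linear_combination f id w hw1
  simp only [id_eq] at h
  rw [← h]
  have := affineCombination_mem_affineSpan_image (k := ℝ) hw1 (s' := (f : Set 𝔼))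
    (fun i hi hi' => absurd hi hi') id
  simpa using this

/-- On an open simplex with vertex `v`, an affine function that vanishes at the other vertices has
the sign of its value at `v`. -/
theorem InOpenSimplex.coord_eq {f : Finset 𝔼} {v : 𝔼} (hv : v ∉ f) [DecidableEq 𝔼]
    {g : 𝔼 →ᵃ[ℝ] ℝ} (hg : ∀ a ∈ f, g a = 0) {x : 𝔼} (hx : InOpenSimplex (insert v f) x) :
    ∃ c > 0, g x = c * g v := by
  obtain ⟨w, hw, hw1, rfl⟩ := hx
  refine ⟨w v, hw v (Finset.mem_insert_self _ _), ?_⟩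
  rw [affineMap_sum_smul g hw1, Finset.sum_insert hv,
    Finset.sum_eq_zero (fun a ha => by rw [hg a ha, smul_zero]), add_zero, smul_eq_mul]

theorem inOpenSimplex_centroid {f : Finset 𝔼} (hf : f.Nonempty) :
    InOpenSimplex f (f.centroid ℝ id) := by
  have hc : (0 : ℝ) < f.card := by exact_mod_cast hf.card_pos
  have h1 := f.sum_centroidWeights_eq_one_of_nonempty ℝ hf
  refine ⟨f.centroidWeights ℝ, fun a _ => ?_, h1, ?_⟩
  · simpa [Finset.centroidWeights_apply] using hc
  · rw [Finset.centroid_def, Finset.affineCombination_eq_linear_combination _ _ _ h1]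
    rfl

variable {T : Geometry.SimplicialComplex ℝ (EuclideanSpace ℝ (Fin 3))}

/-- Two different tetrahedra with a common face lie on opposite sides of it: otherwise, the points
close to the barycenter of the face on that side would lie in both open tetrahedra. -/
theorem coord_neg_of_common_face [DecidableEq 𝔼] {f : Finset 𝔼} (hf : f.Nonempty) {v₁ v₂ : 𝔼}
    (h₁ : v₁ ∉ f) (h₂ : v₂ ∉ f) (ht₁ : insert v₁ f ∈ cells T) (ht₂ : insert v₂ f ∈ cells T)
    (hne : insert v₁ f ≠ insert v₂ f) {g : 𝔼 →ᵃ[ℝ] ℝ} (hg : ∀ a ∈ f, g a = 0) (hg₁ : 0 < g v₁) :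
    g v₂ < 0 := by
  obtain ⟨w, hw1, hw⟩ := exists_weights (T.indep ht₂.1) ht₂.2 v₁
  have hgw : g v₁ = w v₂ * g v₂ := by
    rw [← hw, affineMap_sum_smul g hw1, Finset.sum_insert h₂,
      Finset.sum_eq_zero (fun a ha => by rw [hg a ha, smul_zero]), add_zero, smul_eq_mul]
  by_contra hcon
  have hw2 : 0 < w v₂ := by
    by_contra h
    nlinarith [mul_nonneg (neg_nonneg.2 (not_lt.1 h)) (not_lt.1 hcon)]
  have hn : (0 : ℝ) < f.card := by exact_mod_cast hf.card_pos
  set n : ℝ := (f.card : ℝ) with hndef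
  -- a weight of `v₁` for which all weights of the second tetrahedron are positive
  obtain ⟨ε, hε, hε1, hpos⟩ : ∃ ε : ℝ, 0 < ε ∧ ε < 1 ∧ ∀ a ∈ f, 0 < (1 - ε) / n + ε * w a := by
    have h : ∀ᶠ ε in nhdsWithin (0 : ℝ) (Ioi 0), ε < 1 ∧ ∀ a ∈ f, 0 < (1 - ε) / n + ε * w a := by
      have h1 : ∀ᶠ ε in nhds (0 : ℝ), ε < 1 ∧ ∀ a ∈ f, 0 < (1 - ε) / n + ε * w a := by
        refine (eventually_lt_nhds one_pos).and ((Finset.eventually_all f).2 fun a _ => ?_)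
        have hcont : Continuous fun ε : ℝ => (1 - ε) / n + ε * w a := by fun_prop
        refine hcont.continuousAt.eventually (lt_mem_nhds ?_)
        simpa using hn
      exact nhdsWithin_le_nhds h1
    obtain ⟨ε, h, hε⟩ := (h.and self_mem_nhdsWithin).exists
    exact ⟨ε, hε, h⟩
  have hsum : ∑ a ∈ f, (1 - ε) / n = 1 - ε := by
    rw [Finset.sum_const, nsmul_eq_mul, ← hndef]
    field_simp
  have hx1 : InOpenSimplex (insert v₁ f) (∑ a ∈ f, ((1 - ε) / n) • a + ε • v₁) := by
    refine ⟨fun a => if a = v₁ then ε else (1 - ε) / n, fun a _ => ?_, ?_, ?_⟩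
    · dsimp only
      split_ifs
      · exact hε
      · exact div_pos (by linarith) hn
    · rw [Finset.sum_insert h₁, Finset.sum_congr rfl (g := fun _ => (1 - ε) / n)
        (fun a ha => if_neg (ne_of_mem_of_not_mem ha h₁)), hsum]
      simp
    · rw [Finset.sum_insert h₁, Finset.sum_congr rfl (g := fun a => ((1 - ε) / n) • a)
        (fun a ha => by dsimp only; rw [if_neg (ne_of_mem_of_not_mem ha h₁)])]
      simp [add_comm]
  have hx2 : InOpenSimplex (insert v₂ f) (∑ a ∈ f, ((1 - ε) / n) • a + ε • v₁) := by
    refine ⟨fun a => if a = v₂ then ε * w v₂ else (1 - ε) / n + ε * w a, fun a ha => ?_, ?_, ?_⟩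
    · dsimp only
      split_ifs with h
      · exact mul_pos hε hw2
      · exact hpos a (by simpa [h] using ha)
    · rw [Finset.sum_insert h₂] at hw1
      rw [Finset.sum_insert h₂, Finset.sum_congr rfl (g := fun a => (1 - ε) / n + ε * w a)
        (fun a ha => if_neg (ne_of_mem_of_not_mem ha h₂)), Finset.sum_add_distrib, hsum,
        ← Finset.mul_sum,
        if_pos rfl]
      linear_combination ε * hw1
    · rw [Finset.sum_insert h₂] at hw
      rw [Finset.sum_insert h₂, Finset.sum_congr rfl (g := fun a => ((1 - ε) / n) • a + ε • w a • a)
        (fun a ha => by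
          dsimp only
          rw [if_neg (ne_of_mem_of_not_mem ha h₂), add_smul, mul_smul]),
        Finset.sum_add_distrib, ← hw, smul_add, Finset.smul_sum]
      simp only [if_true, mul_smul]
      abel
  exact hne (hx1.unique ht₁.1 ht₂.1 hx2)

theorem exists_eq_insert {f t : Finset 𝔼} [DecidableEq 𝔼] (hf : f.card = 3) (ht : t.card = 4)
    (hft : f ⊆ t) : ∃ v ∉ f, t = insert v f := by
  obtain ⟨v, hv, h⟩ := Finset.exists_eq_insert_iff.2 ⟨hft, by omega⟩
  exact ⟨v, hv, h.symm⟩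

/-- A triangle is a face of at most two tetrahedra. -/
theorem eq_or_eq_of_common_face {f t₁ t₂ t₃ : Finset 𝔼} (hf : f.card = 3) (ht₁ : t₁ ∈ cells T)
    (ht₂ : t₂ ∈ cells T) (ht₃ : t₃ ∈ cells T) (h₁ : f ⊆ t₁) (h₂ : f ⊆ t₂) (h₃ : f ⊆ t₃)
    (hne : t₁ ≠ t₂) : t₃ = t₁ ∨ t₃ = t₂ := by
  classical
  by_contra! hcon
  have hfn : f.Nonempty := Finset.card_pos.1 (by omega)
  obtain ⟨v₁, hv₁, rfl⟩ := exists_eq_insert hf ht₁.2 h₁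
  obtain ⟨v₂, hv₂, rfl⟩ := exists_eq_insert hf ht₂.2 h₂
  obtain ⟨v₃, hv₃, rfl⟩ := exists_eq_insert hf ht₃.2 h₃
  obtain ⟨g, hg, hg1⟩ := exists_coord hv₁ (T.indep ht₁.1) ht₁.2
  have h12 := coord_neg_of_common_face hfn hv₁ hv₂ ht₁ ht₂ hne hg (by rw [hg1]; exact one_pos)
  have h13 := coord_neg_of_common_face hfn hv₁ hv₃ ht₁ ht₃ hcon.1.symm hg
    (by rw [hg1]; exact one_pos)
  have h23 := coord_neg_of_common_face hfn hv₂ hv₃ ht₂ ht₃ hcon.2.symm (g := -g)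
    (fun a ha => by simp [hg a ha]) (by simpa using h12)
  simp at h23
  linarith

theorem exists_simplex {t : Finset 𝔼} (ht : t ∈ cells T) :
    ∃ S : Affine.Simplex ℝ 𝔼 3, range S.points = (t : Set 𝔼) ∧ incenter t = S.incenter := by
  have h : ∃ S : Affine.Simplex ℝ 𝔼 3, range S.points = (t : Set 𝔼) := by
    have e : Fin 4 ≃ t := (Fintype.equivFinOfCardEq (by simp [ht.2])).symm
    refine ⟨⟨fun i => (e i : 𝔼), (T.indep ht.1).comp_embedding e.toEmbedding⟩, ?_⟩
    change range (((↑) : t → 𝔼) ∘ e) = _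
    rw [EquivLike.range_comp]
    simp
  exact ⟨h.choose, h.choose_spec, dif_pos h⟩

theorem inOpenSimplex_incenter {t : Finset 𝔼} (ht : t ∈ cells T) :
    InOpenSimplex t (incenter t) := by
  obtain ⟨S, hS, hi⟩ := exists_simplex ht
  rw [hi]
  exact inOpenSimplex_of_mem_interior S hS S.incenter_mem_interior

/-- The insphere touches the face `f` at its orthogonal projection onto the plane of `f`, which
lies in the relative interior of `f`. -/
theorem inOpenSimplex_orthogonalProjection_incenter {f t : Finset 𝔼} (ht : t ∈ cells T)
    (hf : f.card = 3) (hft : f ⊆ t) [Nonempty (affineSpan ℝ (f : Set 𝔼))] :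
    InOpenSimplex f (EuclideanGeometry.orthogonalProjection (affineSpan ℝ (f : Set 𝔼))
      (incenter t) : 𝔼) := by
  classical
  obtain ⟨S, hS, hi⟩ := exists_simplex ht
  obtain ⟨v, hv, rfl⟩ := exists_eq_insert hf ht.2 hft
  obtain ⟨i, hiv⟩ : v ∈ range S.points := by rw [hS]; simp
  have hr : range (S.faceOpposite i).points = (f : Set 𝔼) := by
    rw [Affine.Simplex.range_faceOpposite_points, compl_eq_univ_sdiff,
      image_sdiff S.independent.injective, image_univ, hS, image_singleton, hiv]
    simp [hv]
  have h := inOpenSimplex_of_mem_interior _ hr (S.touchpoint_empty_mem_interior_faceOpposite i)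
  have key : ∀ (A : AffineSubspace ℝ 𝔼) [Nonempty A],
      A = affineSpan ℝ (range (S.faceOpposite i).points) →
      (EuclideanGeometry.orthogonalProjection A (incenter (insert v f)) : 𝔼) =
        S.touchpoint ∅ i := by
    rintro A _ rfl
    rw [Affine.Simplex.touchpoint, Affine.Simplex.excenter_empty, ← hi]
    rfl
  rwa [key _ (by rw [hr])]

/-! ### Face split points -/

theorem mem_faces_of_subset_cell {s t : Finset 𝔼} (ht : t ∈ cells T) (hs : s.Nonempty)
    (hst : s ⊆ t) : s ∈ T.faces :=
  T.down_closed ht.1 hst hs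

theorem incenter_injOn : InjOn incenter (cells T) := fun _ hs _ ht h =>
  (inOpenSimplex_incenter hs).unique hs.1 ht.1 (h ▸ inOpenSimplex_incenter ht)

/-- The segment between the incenters of two adjacent tetrahedra meets their common face in one
point. It crosses the plane of the face since the incenters lie on opposite sides, and it does so
inside the face since the orthogonal projections of both incenters lie there. -/
theorem exists_segment_inter_face [DecidableEq 𝔼] {f t₁ t₂ : Finset 𝔼} (hf : f.card = 3)
    (ht₁ : t₁ ∈ cells T) (ht₂ : t₂ ∈ cells T) (h₁ : f ⊆ t₁) (h₂ : f ⊆ t₂) (hne : t₁ ≠ t₂) :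
    ∃ z, InOpenSimplex f z ∧ InOpenSimplex {incenter t₁, incenter t₂} z ∧
      ∀ x, x ∈ segment ℝ (incenter t₁) (incenter t₂) → x ∈ hull f → x = z := by
  have hcne : incenter t₁ ≠ incenter t₂ := fun h => hne (incenter_injOn ht₁ ht₂ h)
  have hP₁ := fun h : Nonempty (affineSpan ℝ (f : Set 𝔼)) =>
    inOpenSimplex_orthogonalProjection_incenter ht₁ hf h₁
  have hP₂ := fun h : Nonempty (affineSpan ℝ (f : Set 𝔼)) =>
    inOpenSimplex_orthogonalProjection_incenter ht₂ hf h₂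
  have hc₁ := inOpenSimplex_incenter ht₁
  have hc₂ := inOpenSimplex_incenter ht₂
  have hfn : f.Nonempty := Finset.card_pos.1 (by omega)
  obtain ⟨v₁, hv₁, rfl⟩ := exists_eq_insert hf ht₁.2 h₁
  obtain ⟨v₂, hv₂, rfl⟩ := exists_eq_insert hf ht₂.2 h₂
  obtain ⟨g, hg, hg1⟩ := exists_coord hv₁ (T.indep ht₁.1) ht₁.2
  have hg2 := coord_neg_of_common_face hfn hv₁ hv₂ ht₁ ht₂ hne hg (by rw [hg1]; exact one_pos)
  obtain ⟨k₁, hk₁, hgc₁⟩ := hc₁.coord_eq hv₁ hg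
  obtain ⟨k₂, hk₂, hgc₂⟩ := hc₂.coord_eq hv₂ hg
  set c₁ := incenter (insert v₁ f)
  set c₂ := incenter (insert v₂ f)
  have hpos : 0 < g c₁ := by rw [hgc₁, hg1]; linarith
  have hneg : g c₂ < 0 := by rw [hgc₂]; exact mul_neg_of_pos_of_neg hk₂ hg2
  have hd : 0 < g c₁ - g c₂ := by linarith
  have hgcomb : ∀ a b : ℝ, a + b = 1 → g (a • c₁ + b • c₂) = a * g c₁ + b * g c₂ := by
    intro a b hab
    have h := g.apply_lineMap c₁ c₂ b
    rw [AffineMap.lineMap_apply_module, AffineMap.lineMap_apply_module, ← hab,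
      add_sub_cancel_right] at h
    simpa using h
  have ha : 0 < -g c₂ / (g c₁ - g c₂) := div_pos (by linarith) hd
  have hb : 0 < g c₁ / (g c₁ - g c₂) := div_pos hpos hd
  have hab : -g c₂ / (g c₁ - g c₂) + g c₁ / (g c₁ - g c₂) = 1 := by
    field_simp
    ring
  refine ⟨_, ?_, inOpenSimplex_pair hcne ha hb hab, ?_⟩
  · have : Nonempty (affineSpan ℝ (f : Set 𝔼)) :=
      ((affineSpan_nonempty ℝ).2 (Finset.coe_nonempty.2 hfn)).to_subtype
    set z := (-g c₂ / (g c₁ - g c₂)) • c₁ + (g c₁ / (g c₁ - g c₂)) • c₂ with hz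
    have hgz : g z = 0 := by
      rw [hz, hgcomb _ _ hab]
      field_simp
      ring
    have hzf : z ∈ affineSpan ℝ (f : Set 𝔼) :=
      mem_affineSpan_of_coord_eq_zero hv₁ (T.indep ht₁.1) ht₁.2 hg
        (by rw [hg1]; exact one_ne_zero) hgz
    have hPz : (EuclideanGeometry.orthogonalProjection (affineSpan ℝ (f : Set 𝔼)) z : 𝔼) = z :=
      EuclideanGeometry.orthogonalProjection_eq_self_iff.2 hzf
    have hzl : z = AffineMap.lineMap c₁ c₂ (g c₁ / (g c₁ - g c₂)) := by
      rw [AffineMap.lineMap_apply_module, hz, ← hab, add_sub_cancel_right]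
    let P : 𝔼 →ᵃ[ℝ] 𝔼 := (affineSpan ℝ (f : Set 𝔼)).subtype.comp
      (EuclideanGeometry.orthogonalProjection (affineSpan ℝ (f : Set 𝔼))).toAffineMap
    have hPl := P.apply_lineMap c₁ c₂ (g c₁ / (g c₁ - g c₂))
    rw [← hzl, AffineMap.lineMap_apply_module] at hPl
    have hPz' : P z = z := hPz
    rw [← hPz', hPl]
    refine (hP₁ this).convexComb (hP₂ this) ?_ hb (by ring)
    linarith
  · rintro x ⟨a, b, -, -, hab', rfl⟩ hx
    obtain ⟨w, -, hw1, hw⟩ := Finset.mem_convexHull'.1 hx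
    have hgx : g (a • c₁ + b • c₂) = 0 := by
      rw [← hw, affineMap_sum_smul g hw1]
      exact Finset.sum_eq_zero fun p hp => by rw [hg p hp, smul_zero]
    rw [hgcomb a b hab'] at hgx
    have h1 : a = -g c₂ / (g c₁ - g c₂) := by
      rw [eq_div_iff hd.ne']
      linear_combination hgx - g c₂ * hab'
    have h2 : b = g c₁ / (g c₁ - g c₂) := by
      rw [eq_div_iff hd.ne']
      linear_combination -hgx + g c₁ * hab'
    rw [← h1, ← h2]

variable (T) in
/-- `z` is the split point of the triangle `f`. -/
def IsSplitPoint (f : Finset 𝔼) (z : 𝔼) : Prop :=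
  IsInteriorSplitPoint T f z ∨ IsBoundarySplitPoint T f z

theorem IsSplitPoint.card {f : Finset 𝔼} {z : 𝔼} (h : IsSplitPoint T f z) : f.card = 3 :=
  h.elim (·.1) (·.1)

theorem IsSplitPoint.mem_faces {f : Finset 𝔼} {z : 𝔼} (h : IsSplitPoint T f z) :
    f ∈ T.faces := by
  have hf : f.Nonempty := Finset.card_pos.1 (by rw [h.card]; omega)
  rcases h with ⟨-, t, ht, -, -, -, hft, -⟩ | ⟨-, ⟨t, ⟨ht, hft⟩, -⟩, -⟩
  · exact mem_faces_of_subset_cell ht hf hft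
  · exact mem_faces_of_subset_cell ht hf hft

theorem IsSplitPoint.inOpenSimplex {f : Finset 𝔼} {z : 𝔼} (h : IsSplitPoint T f z) :
    InOpenSimplex f z := by
  classical
  rcases h with ⟨hf, t₁, ht₁, t₂, ht₂, hne, h₁, h₂, hz, hzf⟩ | ⟨hf, -, rfl⟩
  · obtain ⟨z', hz', -, hu⟩ := exists_segment_inter_face hf ht₁ ht₂ h₁ h₂ hne
    rwa [hu z hz hzf]
  · exact inOpenSimplex_centroid (Finset.card_pos.1 (by omega))

theorem IsSplitPoint.face_unique {f f' : Finset 𝔼} {z : 𝔼} (h : IsSplitPoint T f z)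
    (h' : IsSplitPoint T f' z) : f = f' :=
  h.inOpenSimplex.unique h.mem_faces h'.mem_faces h'.inOpenSimplex

theorem not_isBoundarySplitPoint_of_ne {f t₁ t₂ : Finset 𝔼} {z : 𝔼} (ht₁ : t₁ ∈ cells T)
    (ht₂ : t₂ ∈ cells T) (h₁ : f ⊆ t₁) (h₂ : f ⊆ t₂) (hne : t₁ ≠ t₂) :
    ¬ IsBoundarySplitPoint T f z :=
  fun ⟨_, hu, _⟩ => hne (hu.unique ⟨ht₁, h₁⟩ ⟨ht₂, h₂⟩)

theorem IsSplitPoint.unique {f : Finset 𝔼} {z z' : 𝔼} (h : IsSplitPoint T f z)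
    (h' : IsSplitPoint T f z') : z = z' := by
  classical
  rcases h with ⟨hf, t₁, ht₁, t₂, ht₂, hne, h₁, h₂, hz, hzf⟩ | ⟨hf, hu, rfl⟩
  · obtain ⟨x, -, -, hx⟩ := exists_segment_inter_face hf ht₁ ht₂ h₁ h₂ hne
    rcases h' with ⟨-, s₁, hs₁, s₂, hs₂, hne', hf₁, hf₂, hz', hzf'⟩ | hb
    · have hz'' : z' ∈ segment ℝ (incenter t₁) (incenter t₂) := by
        rcases eq_or_eq_of_common_face hf ht₁ ht₂ hs₁ h₁ h₂ hf₁ hne with rfl | rfl <;>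
        rcases eq_or_eq_of_common_face hf ht₁ ht₂ hs₂ h₁ h₂ hf₂ hne with rfl | rfl
        · exact absurd rfl hne'
        · exact hz'
        · rwa [segment_symm]
        · exact absurd rfl hne'
      rw [hx z hz hzf, hx z' hz'' hzf']
    · exact absurd hb (not_isBoundarySplitPoint_of_ne ht₁ ht₂ h₁ h₂ hne)
  · rcases h' with ⟨-, s₁, hs₁, s₂, hs₂, hne', hf₁, hf₂, -⟩ | ⟨-, -, rfl⟩
    · exact absurd (hu.unique ⟨hs₁, hf₁⟩ ⟨hs₂, hf₂⟩) hne'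
    · rfl

theorem exists_isInteriorSplitPoint {f t₁ t₂ : Finset 𝔼} (hf : f.card = 3)
    (ht₁ : t₁ ∈ cells T) (ht₂ : t₂ ∈ cells T) (h₁ : f ⊆ t₁) (h₂ : f ⊆ t₂) (hne : t₁ ≠ t₂) :
    ∃ z, IsInteriorSplitPoint T f z := by
  classical
  obtain ⟨z, hzf, hz, -⟩ := exists_segment_inter_face hf ht₁ ht₂ h₁ h₂ hne
  refine ⟨z, hf, t₁, ht₁, t₂, ht₂, hne, h₁, h₂, ?_, hzf.mem_convexHull⟩
  have := hz.mem_convexHull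
  rwa [Finset.coe_pair, convexHull_pair] at this

theorem exists_isSplitPoint {f t : Finset 𝔼} (hf : f.card = 3) (ht : t ∈ cells T) (hft : f ⊆ t) :
    ∃ z, IsSplitPoint T f z := by
  by_cases h : ∃ t' ∈ cells T, f ⊆ t' ∧ t' ≠ t
  · obtain ⟨t', ht', hft', hne⟩ := h
    obtain ⟨z, hz⟩ := exists_isInteriorSplitPoint hf ht' ht hft' hft hne
    exact ⟨z, .inl hz⟩
  · push Not at h
    exact ⟨_, .inr ⟨hf, ⟨t, ⟨ht, hft⟩, fun t' ht' => h t' ht'.1 ht'.2⟩, rfl⟩⟩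

/-- The data of an interior split point. -/
theorem IsInteriorSplitPoint.exists_cells {f : Finset 𝔼} {z : 𝔼} [DecidableEq 𝔼]
    (h : IsInteriorSplitPoint T f z) :
    ∃ t₁ ∈ cells T, ∃ t₂ ∈ cells T, t₁ ≠ t₂ ∧ f ⊆ t₁ ∧ f ⊆ t₂ ∧
      (∀ t ∈ cells T, f ⊆ t → t = t₁ ∨ t = t₂) ∧ InOpenSimplex {incenter t₁, incenter t₂} z := by
  obtain ⟨hf, t₁, ht₁, t₂, ht₂, hne, h₁, h₂, hz, hzf⟩ := h
  obtain ⟨x, -, hx, hu⟩ := exists_segment_inter_face hf ht₁ ht₂ h₁ h₂ hne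
  refine ⟨t₁, ht₁, t₂, ht₂, hne, h₁, h₂, fun t ht hft =>
    eq_or_eq_of_common_face hf ht₁ ht₂ ht h₁ h₂ hft hne, ?_⟩
  rwa [hu z hz hzf]

/-! ### The tetrahedra of the refinement as flags -/

variable (T) in
/-- The combinatorial data of a tetrahedron of the Worsey-Farin triangulation: a tetrahedron `t`
of `T`, a face `f` of `t` with its split point `z`, and an edge `e` of `f`. -/
structure Flag where
  t : Finset 𝔼
  f : Finset 𝔼
  z : 𝔼
  e : Finset 𝔼
  ht : t ∈ cells T
  hft : f ⊆ t
  hz : IsSplitPoint T f z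
  hef : e ⊆ f
  he : e.card = 2

namespace Flag

open scoped Classical in
/-- The vertices of the tetrahedron with the given data. -/
def verts (G : Flag T) : Finset 𝔼 := insert (incenter G.t) (insert G.z G.e)

theorem verts_mem (G : Flag T) : G.verts ∈ wfCells T :=
  ⟨G.t, G.ht, G.f, G.hft, G.z, G.hz, G.e, G.hef, G.he, rfl⟩

/-- The tetrahedron with the given data. -/
def tet (G : Flag T) : wfCells T := ⟨G.verts, G.verts_mem⟩

theorem exists_verts_eq {K : Finset 𝔼} (hK : K ∈ wfCells T) : ∃ G : Flag T, G.verts = K := by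
  obtain ⟨t, ht, f, hft, z, hz, e, hef, he, rfl⟩ := hK
  exact ⟨⟨t, f, z, e, ht, hft, hz, hef, he⟩, rfl⟩

theorem exists_tet_eq (K : wfCells T) : ∃ G : Flag T, G.tet = K := by
  obtain ⟨G, hG⟩ := exists_verts_eq K.2
  exact ⟨G, Subtype.ext hG⟩

theorem mem_verts {G : Flag T} {x : 𝔼} : x ∈ G.verts ↔ x = incenter G.t ∨ x = G.z ∨ x ∈ G.e := by
  simp [verts]

theorem singleton_mem_faces_of_mem (G : Flag T) {a : 𝔼} (ha : a ∈ G.f) : {a} ∈ T.faces :=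
  mem_faces_of_subset_cell G.ht (by simp) (by simpa using G.hft ha)

theorem f_mem (G : Flag T) : G.f ∈ T.faces := G.hz.mem_faces

theorem card_f (G : Flag T) : G.f.card = 3 := G.hz.card

theorem incenter_mem_verts {G : Flag T} {t : Finset 𝔼} (ht : t ∈ cells T) :
    incenter t ∈ G.verts ↔ t = G.t := by
  rw [mem_verts]
  refine ⟨?_, fun h => .inl (by rw [h])⟩
  have hi := inOpenSimplex_incenter ht
  rintro (h | h | h)
  · exact incenter_injOn ht G.ht h
  · rw [h] at hi
    have := congrArg Finset.card (hi.unique ht.1 G.f_mem G.hz.inOpenSimplex)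
    rw [ht.2, G.card_f] at this
    omega
  · have := congrArg Finset.card
      (hi.unique ht.1 (G.singleton_mem_faces_of_mem (G.hef h)) (inOpenSimplex_singleton _))
    rw [ht.2, Finset.card_singleton] at this
    omega

theorem splitPoint_mem_verts {G : Flag T} {f : Finset 𝔼} {z : 𝔼} (hz : IsSplitPoint T f z) :
    z ∈ G.verts ↔ f = G.f := by
  rw [mem_verts]
  have hi := hz.inOpenSimplex
  refine ⟨?_, fun h => .inr (.inl ?_)⟩
  · rintro (h | h | h)
    · rw [h] at hi
      have := congrArg Finset.card (hi.unique hz.mem_faces G.ht.1 (inOpenSimplex_incenter G.ht))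
      rw [G.ht.2, hz.card] at this
      omega
    · exact hz.face_unique (h ▸ G.hz)
    · have := congrArg Finset.card (hi.unique hz.mem_faces
        (G.singleton_mem_faces_of_mem (G.hef h)) (inOpenSimplex_singleton _))
      rw [hz.card, Finset.card_singleton] at this
      omega
  · subst h
    exact hz.unique G.hz

theorem vertex_mem_verts {G : Flag T} {a : 𝔼} (ha : {a} ∈ T.faces) :
    a ∈ G.verts ↔ a ∈ G.e := by
  rw [mem_verts]
  refine ⟨?_, fun h => .inr (.inr h)⟩
  have hi := inOpenSimplex_singleton a
  rintro (h | h | h)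
  · have := congrArg Finset.card
      (InOpenSimplex.unique ha G.ht.1 hi (h ▸ inOpenSimplex_incenter G.ht))
    rw [G.ht.2, Finset.card_singleton] at this
    omega
  · have := congrArg Finset.card (InOpenSimplex.unique ha G.f_mem hi (h ▸ G.hz.inOpenSimplex))
    rw [G.card_f, Finset.card_singleton] at this
    omega
  · exact h

theorem z_notMem_e (G : Flag T) : G.z ∉ G.e := fun h => by
  have := congrArg Finset.card (G.hz.inOpenSimplex.unique G.f_mem
    (G.singleton_mem_faces_of_mem (G.hef h)) (inOpenSimplex_singleton _))
  rw [G.card_f, Finset.card_singleton] at this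
  omega

theorem incenter_ne_z (G : Flag T) : incenter G.t ≠ G.z := fun h => by
  have := congrArg Finset.card (G.hz.inOpenSimplex.unique G.f_mem G.ht.1
    (h ▸ inOpenSimplex_incenter G.ht))
  rw [G.card_f, G.ht.2] at this
  omega

theorem incenter_notMem_e (G : Flag T) : incenter G.t ∉ G.e := fun h => by
  have := congrArg Finset.card ((inOpenSimplex_incenter G.ht).unique G.ht.1
    (G.singleton_mem_faces_of_mem (G.hef h)) (inOpenSimplex_singleton _))
  rw [G.ht.2, Finset.card_singleton] at this
  omega

theorem subset_verts_iff {G : Flag T} {s : Finset 𝔼} (hs : ∀ a ∈ s, {a} ∈ T.faces) :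
    s ⊆ G.verts ↔ s ⊆ G.e :=
  forall₂_congr fun _ ha => vertex_mem_verts (hs _ ha)

open scoped Classical in
theorem card_verts_inter (G H : Flag T) : (G.verts ∩ H.verts).card =
    (if G.t = H.t then 1 else 0) + (if G.f = H.f then 1 else 0) + (G.e ∩ H.e).card := by
  have h1 : G.e ∩ H.verts = G.e ∩ H.e := by
    ext a
    simp only [Finset.mem_inter]
    exact and_congr_right fun h => vertex_mem_verts (G.singleton_mem_faces_of_mem (G.hef h))
  have h2 : (insert G.z G.e ∩ H.verts).card = (if G.f = H.f then 1 else 0) + (G.e ∩ H.e).card := by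
    split_ifs with h
    · rw [Finset.insert_inter_of_mem ((splitPoint_mem_verts G.hz).2 h), h1,
        Finset.card_insert_of_notMem (fun hz => G.z_notMem_e (Finset.mem_of_mem_inter_left hz)),
        add_comm]
    · rw [Finset.insert_inter_of_notMem (fun hz => h ((splitPoint_mem_verts G.hz).1 hz)), h1,
        zero_add]
  rw [add_assoc, ← h2]
  have hn : incenter G.t ∉ insert G.z G.e := by simp [G.incenter_ne_z, G.incenter_notMem_e]
  split_ifs with h
  · rw [verts, Finset.insert_inter_of_mem ((incenter_mem_verts G.ht).2 h),
      Finset.card_insert_of_notMem (fun hz => hn (Finset.mem_of_mem_inter_left hz)), add_comm]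
  · rw [verts, Finset.insert_inter_of_notMem (fun hz => h ((incenter_mem_verts G.ht).1 hz)),
      zero_add]

/-- The data of a tetrahedron can be recovered from its vertices, since the incenters, the split
points and the vertices of `T` lie in open simplices of different dimensions. -/
theorem tet_eq_iff {G H : Flag T} : G.tet = H.tet ↔ G.t = H.t ∧ G.f = H.f ∧ G.e = H.e := by
  constructor
  · intro h
    have hv : G.verts = H.verts := congrArg Subtype.val h
    refine ⟨(incenter_mem_verts G.ht).1 (hv ▸ mem_verts.2 (.inl rfl)),
      (splitPoint_mem_verts G.hz).1 (hv ▸ mem_verts.2 (.inr (.inl rfl))), ?_⟩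
    refine Finset.eq_of_subset_of_card_le ?_ (by rw [G.he, H.he])
    rw [← subset_verts_iff fun a ha => G.singleton_mem_faces_of_mem (G.hef ha), ← hv]
    exact fun a ha => mem_verts.2 (.inr (.inr ha))
  · rintro ⟨h1, h2, h3⟩
    have hz : G.z = H.z := G.hz.unique (h2 ▸ H.hz)
    apply Subtype.ext
    simp only [tet, verts, h1, h3, hz]

/-- Two tetrahedra at the same split point share a face if they lie on the same side of the split
face, or if they are mirror images of each other at the same edge of it. -/
theorem shareFace_iff {G H : Flag T} (hf : G.f = H.f) (hne : G.tet ≠ H.tet) :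
    ShareFace G.tet.1 H.tet.1 ↔ G.t = H.t ∨ G.e = H.e := by
  classical
  have hc : ShareFace G.tet.1 H.tet.1 ↔ (G.verts ∩ H.verts).card = 3 := by
    unfold ShareFace
    convert Iff.rfl <;> rfl
  rw [hc, card_verts_inter, if_pos hf]
  have hu : (G.e ∪ H.e).card ≤ 3 := by
    exact (Finset.card_le_card (Finset.union_subset G.hef (hf ▸ H.hef))).trans G.card_f.le
  have hi := Finset.card_union_add_card_inter G.e H.e
  rw [G.he, H.he] at hi
  have hle : (G.e ∩ H.e).card ≤ 2 := G.he ▸ Finset.card_le_card Finset.inter_subset_left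
  have heq : (G.e ∩ H.e).card = 2 ↔ G.e = H.e := by
    constructor
    · intro h
      have h1 : G.e ∩ H.e = G.e :=
        Finset.eq_of_subset_of_card_le Finset.inter_subset_left (by rw [h, G.he])
      have h2 : G.e ∩ H.e = H.e :=
        Finset.eq_of_subset_of_card_le Finset.inter_subset_right (by rw [h, H.he])
      rw [← h1, h2]
    · intro h
      rw [h, Finset.inter_self, H.he]
  by_cases ht : G.t = H.t
  · rw [if_pos ht]
    have hne' : G.e ≠ H.e := fun h => hne (tet_eq_iff.2 ⟨ht, hf, h⟩)
    have : (G.e ∩ H.e).card ≠ 2 := fun h => hne' (heq.1 h)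
    simp only [ht, true_or, iff_true]
    omega
  · rw [if_neg ht]
    simp only [ht, false_or, ← heq]
    omega

end Flag

/-! ### The singular edges -/

theorem not_subset_affineSpan_of_card_three {t s : Finset 𝔼} (ht : t ∈ cells T)
    (hs : s.card = 3) : ¬ (t : Set 𝔼) ⊆ affineSpan ℝ (s : Set 𝔼) := fun h => by
  have := (T.indep ht.1).card_le_card_of_subset_affineSpan h
  rw [hs, ht.2] at this
  omega

theorem exists_eq_pair {α : Type*} [DecidableEq α] {s : Finset α} (hs : s.card = 2) {a : α}
    (ha : a ∈ s) : ∃ b, a ≠ b ∧ s = {a, b} := by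
  obtain ⟨x, y, hxy, he⟩ := Finset.card_eq_two.1 hs
  rw [he, Finset.mem_insert, Finset.mem_singleton] at ha
  rcases ha with rfl | rfl
  · exact ⟨y, hxy, he⟩
  · exact ⟨x, hxy.symm, by rw [he, Finset.pair_comm]⟩

namespace Flag

theorem exists_third_vertex (G : Flag T) [DecidableEq 𝔼] : ∃ d ∉ G.e, G.f = insert d G.e := by
  obtain ⟨d, hd, h⟩ := Finset.exists_eq_insert_iff.2 ⟨G.hef, by rw [G.he, G.card_f]⟩
  exact ⟨d, hd, h.symm⟩

/-- The flag with another edge of the same face. -/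
def withEdge (G : Flag T) (e : Finset 𝔼) (hef : e ⊆ G.f) (he : e.card = 2) : Flag T :=
  ⟨G.t, G.f, G.z, e, G.ht, G.hft, G.hz, hef, he⟩

/-- The flag with another tetrahedron at the same face. -/
def withCell (G : Flag T) (t : Finset 𝔼) (ht : t ∈ cells T) (hft : G.f ⊆ t) : Flag T :=
  ⟨t, G.f, G.z, G.e, ht, hft, G.hz, G.hef, G.he⟩

theorem face_subset_of_subset {G : Flag T} {S : AffineSubspace ℝ 𝔼} (hz : G.z ∈ S)
    (he : ∀ a ∈ G.e, a ∈ S) : ∀ a ∈ G.f, a ∈ S := by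
  classical
  obtain ⟨d, hd, hf⟩ := G.exists_third_vertex
  have hdS : d ∈ S := G.hz.inOpenSimplex.exchange (by simp [hf]) hz fun a ha hne =>
    he a (by rw [hf, Finset.mem_insert] at ha; exact ha.resolve_left hne)
  intro a ha
  rw [hf, Finset.mem_insert] at ha
  rcases ha with rfl | ha
  · exact hdS
  · exact he a ha

theorem cell_subset_of_subset {G : Flag T} {S : AffineSubspace ℝ 𝔼} (hc : incenter G.t ∈ S)
    (hf : ∀ a ∈ G.f, a ∈ S) : (G.t : Set 𝔼) ⊆ S := by
  classical
  obtain ⟨v, hv, ht⟩ := exists_eq_insert G.card_f G.ht.2 G.hft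
  have hvS : v ∈ S := (inOpenSimplex_incenter G.ht).exchange (by simp [ht]) hc fun a ha hne =>
    hf a (by rw [ht, Finset.mem_insert] at ha; exact ha.resolve_left hne)
  intro a ha
  rw [Finset.mem_coe, ht, Finset.mem_insert] at ha
  rcases ha with rfl | ha
  · exact hvS
  · exact hf a ha

/-- The vertices of a tetrahedron of the refinement are not coplanar. -/
theorem affineSpan_ne {G : Flag T} [DecidableEq 𝔼] {φ φ' : Finset 𝔼} (hφ : φ.card = 3)
    (h : G.verts ⊆ φ ∪ φ') : affineSpan ℝ (φ : Set 𝔼) ≠ affineSpan ℝ (φ' : Set 𝔼) := by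
  intro heq
  have hS : ∀ a ∈ G.verts, a ∈ affineSpan ℝ (φ : Set 𝔼) := by
    intro a ha
    rcases Finset.mem_union.1 (h ha) with h | h
    · exact subset_affineSpan ℝ _ h
    · rw [heq]
      exact subset_affineSpan ℝ _ h
  exact not_subset_affineSpan_of_card_three G.ht hφ
    (cell_subset_of_subset (hS _ (mem_verts.2 (.inl rfl)))
      (face_subset_of_subset (hS _ (mem_verts.2 (.inr (.inl rfl))))
        fun a ha => hS a (mem_verts.2 (.inr (.inr ha)))))

theorem mem_wfFaces {G : Flag T} {φ : Finset 𝔼} (h : φ ⊆ G.verts) (hφ : φ.card = 3) :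
    φ ∈ wfFaces T := ⟨hφ, _, G.verts_mem, h⟩

end Flag

theorem notMem_singularEdges {e φ₁ φ₂ φ₃ : Finset 𝔼} (h₁ : φ₁ ∈ wfFaces T) (h₂ : φ₂ ∈ wfFaces T)
    (h₃ : φ₃ ∈ wfFaces T) (he₁ : e ⊆ φ₁) (he₂ : e ⊆ φ₂) (he₃ : e ⊆ φ₃)
    (h12 : affineSpan ℝ (φ₁ : Set 𝔼) ≠ affineSpan ℝ (φ₂ : Set 𝔼))
    (h13 : affineSpan ℝ (φ₁ : Set 𝔼) ≠ affineSpan ℝ (φ₃ : Set 𝔼))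
    (h23 : affineSpan ℝ (φ₂ : Set 𝔼) ≠ affineSpan ℝ (φ₃ : Set 𝔼)) : e ∉ singularEdges T := by
  rintro ⟨-, h⟩
  obtain ⟨P, Q, -, hPQ⟩ := Set.ncard_eq_two.1 h
  have k₁ := hPQ.subset ⟨φ₁, h₁, he₁, rfl⟩
  have k₂ := hPQ.subset ⟨φ₂, h₂, he₂, rfl⟩
  have k₃ := hPQ.subset ⟨φ₃, h₃, he₃, rfl⟩
  simp only [mem_insert_iff, mem_singleton_iff] at k₁ k₂ k₃
  rcases k₁ with k₁ | k₁ <;> rcases k₂ with k₂ | k₂ <;> rcases k₃ with k₃ | k₃ <;> simp_all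

/-- The segment from an incenter to the split point of a face lies on three planes. -/
theorem incenter_splitPoint_notMem_singularEdges [DecidableEq 𝔼] (G : Flag T) :
    {incenter G.t, G.z} ∉ singularEdges T := by
  obtain ⟨a, b, d, hab, had, hbd, hf⟩ := Finset.card_eq_three.1 G.card_f
  let G₁ := G.withEdge {a, b} (by rw [hf]; intro x; simp; tauto) (Finset.card_pair hab)
  let G₂ := G.withEdge {a, d} (by rw [hf]; intro x; simp; tauto) (Finset.card_pair had)
  let G₃ := G.withEdge {b, d} (by rw [hf]; intro x; simp; tauto) (Finset.card_pair hbd)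
  have hm₁ : ∀ x, x ∈ G₁.verts ↔ x = incenter G.t ∨ x = G.z ∨ x = a ∨ x = b := fun x => by
    rw [Flag.mem_verts]; simp [G₁, Flag.withEdge]
  have hm₂ : ∀ x, x ∈ G₂.verts ↔ x = incenter G.t ∨ x = G.z ∨ x = a ∨ x = d := fun x => by
    rw [Flag.mem_verts]; simp [G₂, Flag.withEdge]
  have hm₃ : ∀ x, x ∈ G₃.verts ↔ x = incenter G.t ∨ x = G.z ∨ x = b ∨ x = d := fun x => by
    rw [Flag.mem_verts]; simp [G₃, Flag.withEdge]
  have hcard : ∀ H : Flag T, H.t = G.t → H.z = G.z → ∀ p ∈ H.e,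
      ({incenter G.t, G.z, p} : Finset 𝔼).card = 3 := by
    intro H h1 h2 p hp
    refine Finset.card_eq_three.2 ⟨_, _, _, G.incenter_ne_z, ?_, ?_, rfl⟩
    · rintro h
      exact H.incenter_notMem_e (by rw [h1, h]; exact hp)
    · rintro h
      exact H.z_notMem_e (by rw [h2, h]; exact hp)
  have ca := hcard G₁ rfl rfl a (by simp [G₁, Flag.withEdge])
  have cb := hcard G₁ rfl rfl b (by simp [G₁, Flag.withEdge])
  have cd := hcard G₂ rfl rfl d (by simp [G₂, Flag.withEdge])
  refine notMem_singularEdges (φ₁ := {incenter G.t, G.z, a}) (φ₂ := {incenter G.t, G.z, b})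
    (φ₃ := {incenter G.t, G.z, d}) (G₁.mem_wfFaces ?_ ca) (G₁.mem_wfFaces ?_ cb)
    (G₂.mem_wfFaces ?_ cd) ?_ ?_ ?_ (G₁.affineSpan_ne ca ?_) (G₂.affineSpan_ne ca ?_)
    (G₃.affineSpan_ne cb ?_) <;> intro x <;>
    simp only [hm₁, hm₂, hm₃, Finset.mem_insert, Finset.mem_singleton, Finset.mem_union] <;> tauto

/-- The segment from an incenter to a vertex lies on three planes. -/
theorem incenter_vertex_notMem_singularEdges [DecidableEq 𝔼] (G : Flag T) {a : 𝔼} (ha : a ∈ G.e) :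
    {incenter G.t, a} ∉ singularEdges T := by
  obtain ⟨d, hd, hf⟩ := G.exists_third_vertex
  obtain ⟨b, hab, he⟩ := exists_eq_pair G.he ha
  rw [he] at hd hf
  have hda : d ≠ a := fun h => hd (by simp [h])
  have hdb : d ≠ b := fun h => hd (by simp [h])
  let G' := G.withEdge {a, d} (by rw [hf]; intro x; simp; tauto) (Finset.card_pair hda.symm)
  have hm : ∀ x, x ∈ G.verts ↔ x = incenter G.t ∨ x = G.z ∨ x = a ∨ x = b := fun x => by
    rw [Flag.mem_verts]; simp [he]
  have hm' : ∀ x, x ∈ G'.verts ↔ x = incenter G.t ∨ x = G.z ∨ x = a ∨ x = d := fun x => by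
    rw [Flag.mem_verts]; simp [G', Flag.withEdge]
  have hca : incenter G.t ≠ a := fun h => G.incenter_notMem_e (by simp [h, he])
  have hcb : incenter G.t ≠ b := fun h => G.incenter_notMem_e (by simp [h, he])
  have hcd : incenter G.t ≠ d := fun h => G'.incenter_notMem_e (by simp [G', Flag.withEdge, h])
  have hza : a ≠ G.z := fun h => G.z_notMem_e (by simp [← h, he])
  have c₁ : ({incenter G.t, a, G.z} : Finset 𝔼).card = 3 :=
    Finset.card_eq_three.2 ⟨_, _, _, hca, G.incenter_ne_z, hza, rfl⟩
  have c₂ : ({incenter G.t, a, b} : Finset 𝔼).card = 3 :=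
    Finset.card_eq_three.2 ⟨_, _, _, hca, hcb, hab, rfl⟩
  have c₃ : ({incenter G.t, a, d} : Finset 𝔼).card = 3 :=
    Finset.card_eq_three.2 ⟨_, _, _, hca, hcd, hda.symm, rfl⟩
  refine notMem_singularEdges (φ₁ := {incenter G.t, a, G.z}) (φ₂ := {incenter G.t, a, b})
    (φ₃ := {incenter G.t, a, d}) (G.mem_wfFaces ?_ c₁) (G.mem_wfFaces ?_ c₂)
    (G'.mem_wfFaces ?_ c₃) ?_ ?_ ?_ (G.affineSpan_ne c₁ ?_) (G'.affineSpan_ne c₁ ?_) ?_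
  on_goal 9 =>
    intro heq
    have h1 := subset_affineSpan ℝ (({incenter G.t, a, b} : Finset 𝔼) : Set 𝔼)
    have h2 := subset_affineSpan ℝ (({incenter G.t, a, d} : Finset 𝔼) : Set 𝔼)
    rw [← heq] at h2
    refine not_subset_affineSpan_of_card_three G.ht c₂
      (G.cell_subset_of_subset (h1 (by simp)) fun x hx => ?_)
    rw [hf, Finset.mem_insert, Finset.mem_insert, Finset.mem_singleton] at hx
    rcases hx with rfl | rfl | rfl
    · exact h2 (by simp)
    · exact h1 (by simp)
    · exact h1 (by simp)
  all_goals
    intro x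
    simp only [hm, hm', Finset.mem_insert, Finset.mem_singleton, Finset.mem_union]
    tauto

/-- An edge of the original triangulation lies on three planes: those of the two faces that meet
there, and the one through the incenter. -/
theorem edge_notMem_singularEdges [DecidableEq 𝔼] (G : Flag T) : G.e ∉ singularEdges T := by
  obtain ⟨d, hd, hf⟩ := G.exists_third_vertex
  obtain ⟨v, hv, ht⟩ := exists_eq_insert G.card_f G.ht.2 G.hft
  have hve : v ∉ G.e := fun h => hv (G.hef h)
  have hf'c : (insert v G.e).card = 3 := by rw [Finset.card_insert_of_notMem hve, G.he]
  have hf't : insert v G.e ⊆ G.t := by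
    rw [ht]
    exact Finset.insert_subset_insert _ G.hef
  obtain ⟨z', hz'⟩ := exists_isSplitPoint hf'c G.ht hf't
  let G' : Flag T := ⟨G.t, insert v G.e, z', G.e, G.ht, hf't, hz', Finset.subset_insert _ _, G.he⟩
  have c₁ : (insert G.z G.e).card = 3 := by rw [Finset.card_insert_of_notMem G.z_notMem_e, G.he]
  have c₂ : (insert z' G.e).card = 3 := by
    rw [Finset.card_insert_of_notMem G'.z_notMem_e, G.he]
  have c₃ : (insert (incenter G.t) G.e).card = 3 := by
    rw [Finset.card_insert_of_notMem G.incenter_notMem_e, G.he]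
  have hm : ∀ x, x ∈ G.verts ↔ x = incenter G.t ∨ x = G.z ∨ x ∈ G.e := fun x => Flag.mem_verts
  have hm' : ∀ x, x ∈ G'.verts ↔ x = incenter G.t ∨ x = z' ∨ x ∈ G.e := fun x => Flag.mem_verts
  refine notMem_singularEdges (φ₁ := insert G.z G.e) (φ₂ := insert z' G.e)
    (φ₃ := insert (incenter G.t) G.e) (G.mem_wfFaces ?_ c₁) (G'.mem_wfFaces ?_ c₂)
    (G.mem_wfFaces ?_ c₃) (Finset.subset_insert _ _) (Finset.subset_insert _ _)
    (Finset.subset_insert _ _) ?_ (G.affineSpan_ne c₁ ?_) (G'.affineSpan_ne c₂ ?_)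
  on_goal 4 =>
    intro heq
    have h1 := subset_affineSpan ℝ ((insert G.z G.e : Finset 𝔼) : Set 𝔼)
    have h2 := subset_affineSpan ℝ ((insert z' G.e : Finset 𝔼) : Set 𝔼)
    rw [← heq] at h2
    have hS : ∀ x ∈ G.f, x ∈ affineSpan ℝ ((insert G.z G.e : Finset 𝔼) : Set 𝔼) :=
      G.face_subset_of_subset (h1 (by simp)) fun x hx => h1 (by simp [hx])
    have hS' : ∀ x ∈ insert v G.e, x ∈ affineSpan ℝ ((insert G.z G.e : Finset 𝔼) : Set 𝔼) :=
      G'.face_subset_of_subset (h2 (by simp [G'])) fun x hx => h1 (Finset.mem_insert_of_mem hx)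
    refine not_subset_affineSpan_of_card_three G.ht c₁ fun x hx => ?_
    rw [Finset.mem_coe, ht, Finset.mem_insert] at hx
    rcases hx with rfl | hx
    · exact hS' x (by simp)
    · exact hS x hx
  all_goals
    intro x
    simp only [hm, hm', Finset.mem_insert, Finset.mem_union]
    tauto

/-- Only the segments from the split point of a face to the vertices of that face can be
singular. -/
theorem exists_eq_of_mem_singularEdges [DecidableEq 𝔼] {e : Finset 𝔼} (he : e ∈ singularEdges T) :
    ∃ G : Flag T, ∃ a ∈ G.e, e = {G.z, a} := by
  obtain ⟨hc, K, hK, heK⟩ := he.1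
  obtain ⟨G, rfl⟩ := Flag.exists_verts_eq hK
  obtain ⟨x, y, hxy, rfl⟩ := Finset.card_eq_two.1 hc
  have hx := Flag.mem_verts.1 (heK (by simp : x ∈ _))
  have hy := Flag.mem_verts.1 (heK (by simp : y ∈ _))
  rcases hx with rfl | rfl | hx <;> rcases hy with rfl | rfl | hy
  · exact absurd rfl hxy
  · exact absurd he (incenter_splitPoint_notMem_singularEdges G)
  · exact absurd he (incenter_vertex_notMem_singularEdges G hy)
  · rw [Finset.pair_comm] at he
    exact absurd he (incenter_splitPoint_notMem_singularEdges G)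
  · exact absurd rfl hxy
  · exact ⟨G, y, hy, rfl⟩
  · rw [Finset.pair_comm] at he
    exact absurd he (incenter_vertex_notMem_singularEdges G hx)
  · exact ⟨G, x, hx, Finset.pair_comm _ _⟩
  · have h : {x, y} = G.e := Finset.eq_of_subset_of_card_le
      (by
        intro p hp
        simp only [Finset.mem_insert, Finset.mem_singleton] at hp
        rcases hp with rfl | rfl <;> assumption)
      (by rw [G.he, Finset.card_pair hxy])
    rw [h] at he
    exact absurd he (edge_notMem_singularEdges G)

/-- The split point of a face lies on the line through the incenters on both sides. -/
theorem incenter_mem_affineSpan {f t t' : Finset 𝔼} {z : 𝔼} (hz : IsSplitPoint T f z)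
    (ht : t ∈ cells T) (ht' : t' ∈ cells T) (hf : f ⊆ t) (hf' : f ⊆ t') {S : AffineSubspace ℝ 𝔼}
    (hzS : z ∈ S) (hS : incenter t ∈ S) : incenter t' ∈ S := by
  classical
  by_cases hne : t = t'
  · rwa [← hne]
  rcases hz with hz | hz
  · obtain ⟨t₁, -, t₂, -, -, -, -, hu, hx⟩ := hz.exists_cells
    have hx' : InOpenSimplex {incenter t, incenter t'} z := by
      rcases hu t ht hf with rfl | rfl <;> rcases hu t' ht' hf' with rfl | rfl
      · exact absurd rfl hne
      · exact hx
      · rwa [Finset.pair_comm]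
      · exact absurd rfl hne
    refine hx'.exchange (by simp) hzS fun a ha hat => ?_
    rw [Finset.mem_insert, Finset.mem_singleton] at ha
    rcases ha with rfl | rfl
    · exact hS
    · exact absurd rfl hat
  · exact absurd hz (not_isBoundarySplitPoint_of_ne ht ht' hf hf' hne)

namespace Flag

theorem pair_subset_verts_iff [DecidableEq 𝔼] {G H : Flag T} {a : 𝔼} (ha : a ∈ G.e) :
    {G.z, a} ⊆ H.verts ↔ G.f = H.f ∧ a ∈ H.e := by
  rw [Finset.insert_subset_iff, Finset.singleton_subset_iff, splitPoint_mem_verts G.hz,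
    vertex_mem_verts (G.singleton_mem_faces_of_mem (G.hef ha))]

/-- A triangle of the refinement that contains a split point and a vertex of the split face either
lies in the face or has the incenter as its third vertex. -/
theorem face_eq [DecidableEq 𝔼] {G : Flag T} {a : 𝔼} (ha : a ∈ G.e) {φ : Finset 𝔼}
    (hφ : φ.card = 3) (h : φ ⊆ G.verts) (hz : G.z ∈ φ) (haφ : a ∈ φ) :
    φ = insert G.z G.e ∨ φ = {G.z, a, incenter G.t} := by
  by_cases hc : incenter G.t ∈ φ
  · right
    symm
    refine Finset.eq_of_subset_of_card_le ?_ ?_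
    · intro x hx
      simp only [Finset.mem_insert, Finset.mem_singleton] at hx
      rcases hx with rfl | rfl | rfl <;> assumption
    · rw [hφ, Finset.card_eq_three.2 ⟨_, _, _, ?_, G.incenter_ne_z.symm, ?_, rfl⟩]
      · exact fun h => G.z_notMem_e (h ▸ ha)
      · exact fun h => G.incenter_notMem_e (h ▸ ha)
  · left
    refine Finset.eq_of_subset_of_card_le ?_ ?_
    · intro x hx
      rcases mem_verts.1 (h hx) with rfl | rfl | hx'
      · exact absurd hx hc
      · simp
      · exact Finset.mem_insert_of_mem hx'
    · rw [hφ, Finset.card_insert_of_notMem G.z_notMem_e, G.he]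

theorem card_insert_z (G : Flag T) [DecidableEq 𝔼] : (insert G.z G.e).card = 3 := by
  rw [Finset.card_insert_of_notMem G.z_notMem_e, G.he]

theorem insert_z_subset_verts (G : Flag T) [DecidableEq 𝔼] : insert G.z G.e ⊆ G.verts := by
  intro x hx
  rw [Finset.mem_insert] at hx
  exact mem_verts.2 (.inr hx)

theorem affineSpan_insert_z (G : Flag T) [DecidableEq 𝔼] :
    affineSpan ℝ ((insert G.z G.e : Finset 𝔼) : Set 𝔼) = affineSpan ℝ (G.f : Set 𝔼) := by
  apply le_antisymm
  · refine affineSpan_le.2 fun x hx => ?_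
    rw [Finset.mem_coe, Finset.mem_insert] at hx
    rcases hx with rfl | hx
    · exact G.hz.inOpenSimplex.mem_affineSpan
    · exact subset_affineSpan ℝ _ (G.hef hx)
  · exact affineSpan_le.2 (G.face_subset_of_subset (subset_affineSpan ℝ _ (by simp))
      fun x hx => subset_affineSpan ℝ _ (by simp [hx]))

theorem pair_mem_wfEdges [DecidableEq 𝔼] {G : Flag T} {a : 𝔼} (ha : a ∈ G.e) :
    {G.z, a} ∈ wfEdges T :=
  ⟨Finset.card_pair fun h => G.z_notMem_e (h ▸ ha), G.verts, G.verts_mem,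
    (pair_subset_verts_iff ha).2 ⟨rfl, ha⟩⟩

/-- The segment from the split point of a face to a vertex of that face is singular: one plane is
that of the face, the other one contains the incenters on both sides of it. -/
theorem pair_mem_singularEdges [DecidableEq 𝔼] {G : Flag T} {a : 𝔼} (ha : a ∈ G.e) :
    {G.z, a} ∈ singularEdges T := by
  refine ⟨pair_mem_wfEdges ha, ?_⟩
  have hca : ({G.z, a, incenter G.t} : Finset 𝔼).card = 3 :=
    Finset.card_eq_three.2 ⟨_, _, _, (ne_of_mem_of_not_mem ha G.z_notMem_e).symm,
      G.incenter_ne_z.symm, fun h => G.incenter_notMem_e (h ▸ ha), rfl⟩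
  have hset : {P : AffineSubspace ℝ 𝔼 | ∃ f ∈ wfFaces T, {G.z, a} ⊆ f ∧
      P = affineSpan ℝ (f : Set 𝔼)} = {affineSpan ℝ (G.f : Set 𝔼),
        affineSpan ℝ (({G.z, a, incenter G.t} : Finset 𝔼) : Set 𝔼)} := by
    apply Subset.antisymm
    · rintro P ⟨φ, ⟨hφ, K, hK, hφK⟩, hzφ, rfl⟩
      obtain ⟨H, rfl⟩ := exists_verts_eq hK
      obtain ⟨hf, haH⟩ := (pair_subset_verts_iff ha).1 (hzφ.trans hφK)
      have hzz : G.z = H.z := G.hz.unique (hf ▸ H.hz)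
      have haφ : a ∈ φ := hzφ (by simp)
      have hzφ' : H.z ∈ φ := hzz ▸ hzφ (by simp)
      rcases face_eq haH hφ hφK hzφ' haφ with rfl | rfl
      · left
        rw [H.affineSpan_insert_z, hf]
      · right
        rw [mem_singleton_iff, hzz]
        apply le_antisymm <;> refine affineSpan_le.2 fun x hx => ?_
        · simp only [Finset.mem_coe, Finset.mem_insert, Finset.mem_singleton] at hx
          rcases hx with rfl | rfl | rfl
          · exact subset_affineSpan ℝ _ (by simp)
          · exact subset_affineSpan ℝ _ (by simp)
          · exact incenter_mem_affineSpan H.hz G.ht H.ht (hf ▸ G.hft) H.hft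
              (subset_affineSpan ℝ _ (by simp)) (subset_affineSpan ℝ _ (by simp))
        · simp only [Finset.mem_coe, Finset.mem_insert, Finset.mem_singleton] at hx
          rcases hx with rfl | rfl | rfl
          · exact subset_affineSpan ℝ _ (by simp)
          · exact subset_affineSpan ℝ _ (by simp)
          · exact incenter_mem_affineSpan H.hz H.ht G.ht H.hft (hf ▸ G.hft)
              (subset_affineSpan ℝ _ (by simp)) (subset_affineSpan ℝ _ (by simp))
    · rintro P (rfl | rfl)
      · refine ⟨insert G.z G.e, mem_wfFaces G.insert_z_subset_verts G.card_insert_z, ?_,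
          G.affineSpan_insert_z.symm⟩
        exact Finset.insert_subset_insert _ (by simpa using ha)
      · refine ⟨{G.z, a, incenter G.t}, G.mem_wfFaces ?_ hca, ?_, rfl⟩
        · intro x hx
          simp only [Finset.mem_insert, Finset.mem_singleton] at hx
          rw [mem_verts]
          rcases hx with rfl | rfl | rfl <;> simp [ha]
        · intro x hx
          simp only [Finset.mem_insert, Finset.mem_singleton] at hx ⊢
          tauto
  rw [hset]
  refine Set.ncard_pair ?_
  rw [← G.affineSpan_insert_z]
  refine G.affineSpan_ne G.card_insert_z fun x hx => ?_
  simp only [mem_verts] at hx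
  simp only [Finset.mem_union, Finset.mem_insert, Finset.mem_singleton]
  tauto

theorem tet_injective_data {G H : Flag T} (h : G.verts = H.verts) :
    G.t = H.t ∧ G.f = H.f ∧ G.e = H.e :=
  tet_eq_iff.1 (Subtype.ext h)

theorem not_isBoundaryEdge [DecidableEq 𝔼] {G : Flag T} (hz : IsInteriorSplitPoint T G.f G.z)
    {a : 𝔼} (ha : a ∈ G.e) : ¬ IsBoundaryEdge T {G.z, a} := by
  rintro ⟨-, φ, ⟨hφ, -⟩, hzφ, K, ⟨hK, hφK⟩, hu⟩
  obtain ⟨H, rfl⟩ := exists_verts_eq hK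
  obtain ⟨hf, haH⟩ := (pair_subset_verts_iff ha).1 (hzφ.trans hφK)
  have hzz : G.z = H.z := G.hz.unique (hf ▸ H.hz)
  have haφ : a ∈ φ := hzφ (by simp)
  have hzφ' : H.z ∈ φ := hzz ▸ hzφ (by simp)
  rcases face_eq haH hφ hφK hzφ' haφ with rfl | rfl
  · -- the tetrahedron on the other side
    obtain ⟨t₁, ht₁, t₂, ht₂, hne, h₁, h₂, -⟩ := hz.exists_cells
    rw [hf] at h₁ h₂
    obtain ⟨t, ht, hft, hne'⟩ : ∃ t ∈ cells T, H.f ⊆ t ∧ t ≠ H.t := by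
      by_cases h : t₁ = H.t
      · exact ⟨t₂, ht₂, h₂, fun h' => hne (h.trans h'.symm)⟩
      · exact ⟨t₁, ht₁, h₁, h⟩
    have := hu (H.withCell t ht hft).verts
      ⟨verts_mem _, (H.withCell t ht hft).insert_z_subset_verts⟩
    exact hne' (tet_injective_data this).1
  · -- the tetrahedron at the other edge of the face through `a`
    obtain ⟨b, hab, he⟩ := exists_eq_pair H.he haH
    obtain ⟨d, hd, hfd⟩ := H.exists_third_vertex
    have hda : a ≠ d := fun h => hd (h ▸ haH)
    let H' := H.withEdge {a, d} (by
      rw [hfd, he]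
      intro x
      simp
      tauto) (Finset.card_pair hda)
    have := hu H'.verts ⟨verts_mem _, fun x hx => by
      simp only [Finset.mem_insert, Finset.mem_singleton] at hx
      rw [mem_verts]
      rcases hx with rfl | rfl | rfl <;> simp [H', withEdge]⟩
    have h' : ({a, d} : Finset 𝔼) = H.e := (tet_injective_data this).2.2
    exact hd (h' ▸ by simp)

theorem isBoundaryEdge [DecidableEq 𝔼] {G : Flag T} (hz : IsBoundarySplitPoint T G.f G.z)
    {a : 𝔼} (ha : a ∈ G.e) : IsBoundaryEdge T {G.z, a} := by
  refine ⟨pair_mem_wfEdges ha, insert G.z G.e,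
    mem_wfFaces G.insert_z_subset_verts G.card_insert_z,
    Finset.insert_subset_insert _ (by simpa using ha), G.verts,
    ⟨G.verts_mem, G.insert_z_subset_verts⟩, ?_⟩
  rintro K ⟨hK, hGK⟩
  obtain ⟨H, rfl⟩ := exists_verts_eq hK
  have hf : G.f = H.f := (splitPoint_mem_verts G.hz).1 (hGK (by simp))
  have he : G.e = H.e := by
    refine Finset.eq_of_subset_of_card_le ?_ (by rw [G.he, H.he])
    rw [← subset_verts_iff fun a ha => G.singleton_mem_faces_of_mem (G.hef ha)]
    exact (Finset.subset_insert _ _).trans hGK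
  have ht : G.t = H.t := hz.2.1.unique ⟨G.ht, G.hft⟩ ⟨H.ht, hf ▸ H.hft⟩
  exact (congrArg Subtype.val (tet_eq_iff.2 ⟨ht, hf, he⟩ : G.tet = H.tet)).symm

end Flag

/-! ### The constraints of the pressure space -/

set_option synthInstance.maxSize 1000 in
/-- A cyclic labeling of the four cells of a two-by-two table, with neighbours in a common row
or column, runs around the table. -/
theorem bool_cycle (p₀ p₁ p₂ p₃ : Bool × Bool) (h01 : p₀ ≠ p₁) (h02 : p₀ ≠ p₂) (h13 : p₁ ≠ p₃)
    (h12 : p₁ ≠ p₂) (h23 : p₂ ≠ p₃) (h30 : p₃ ≠ p₀)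
    (s01 : p₀.1 = p₁.1 ∨ p₀.2 = p₁.2) (s12 : p₁.1 = p₂.1 ∨ p₁.2 = p₂.2)
    (s23 : p₂.1 = p₃.1 ∨ p₂.2 = p₃.2) (s30 : p₃.1 = p₀.1 ∨ p₃.2 = p₀.2) :
    p₂ = (!p₀.1, !p₀.2) ∧
      (p₁ = (!p₀.1, p₀.2) ∧ p₃ = (p₀.1, !p₀.2) ∨ p₁ = (p₀.1, !p₀.2) ∧ p₃ = (!p₀.1, p₀.2)) := by
  revert p₀ p₁ p₂ p₃
  decide

/-- If the four tetrahedra at an edge are arranged in a table in such a way that two of them share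
a face when they are in the same row or column, then the alternating sums of all cyclic labelings
vanish together. -/
theorem forall_interiorEdgeLabeling_iff {e : Finset 𝔼} {C : Bool × Bool → wfCells T}
    (hC : Function.Injective C) (hr : range C = {L | e ⊆ L.1})
    (hs : ∀ x y, x ≠ y → (ShareFace (C x).1 (C y).1 ↔ x.1 = y.1 ∨ x.2 = y.2)) (q : P0 T) :
    (∀ K : Fin 4 → wfCells T, IsInteriorEdgeLabeling T e K →
      q (K 0) - q (K 1) + q (K 2) - q (K 3) = 0) ↔
    q (C (true, true)) - q (C (false, true)) = q (C (true, false)) - q (C (false, false)) := by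
  constructor
  · intro h
    have hp : Function.Injective ![(true, true), (true, false), (false, false), (false, true)] := by
      decide
    have hps : ∀ x : Bool × Bool,
        ∃ j, ![(true, true), (true, false), (false, false), (false, true)] j = x := by
      decide
    have hK := h (fun j => C (![(true, true), (true, false), (false, false), (false, true)] j))
      ⟨hC.comp hp, ?_, ?_⟩
    · simp at hK
      linarith
    · rw [← hr]
      ext L
      constructor
      · rintro ⟨j, rfl⟩
        exact ⟨_, rfl⟩
      · rintro ⟨x, rfl⟩
        obtain ⟨j, rfl⟩ := hps x
        exact ⟨j, rfl⟩
    · intro j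
      refine (hs _ _ fun h => ?_).2 ?_
      · have := hp h
        revert this
        revert j
        decide
      · revert j
        decide
  · rintro h K ⟨hK, hKr, hKs⟩
    have hx : ∀ j, ∃ x, C x = K j := fun j => by
      have : K j ∈ range C := by
        rw [hr, ← hKr]
        exact ⟨j, rfl⟩
      exact this
    choose p hp using hx
    have hpi : ∀ i j, i ≠ j → p i ≠ p j := fun i j hij h =>
      hij (hK (by rw [← hp, ← hp, h]))
    have hsh : ∀ j, (p j).1 = (p (j + 1)).1 ∨ (p j).2 = (p (j + 1)).2 := fun j => by
      rw [← hs _ _ (hpi _ _ (by revert j; decide)), hp, hp]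
      exact hKs j
    obtain ⟨h2, h13⟩ := bool_cycle (p 0) (p 1) (p 2) (p 3) (hpi _ _ (by decide))
      (hpi _ _ (by decide)) (hpi _ _ (by decide)) (hpi _ _ (by decide)) (hpi _ _ (by decide))
      (hpi _ _ (by decide)) (hsh 0) (hsh 1) (hsh 2) (hsh 3)
    rw [← hp 0, ← hp 1, ← hp 2, ← hp 3, h2]
    generalize p 0 = x at *
    rcases h13 with ⟨h1, h3⟩ | ⟨h1, h3⟩ <;> rw [h1, h3] <;> rcases x with ⟨_ | _, _ | _⟩ <;>
      simp only [Bool.not_true, Bool.not_false] <;> linarith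

theorem forall_boundaryEdgeLabeling_iff {e : Finset 𝔼} {C : Bool → wfCells T}
    (hC : Function.Injective C) (hr : range C = {L | e ⊆ L.1})
    (hs : ShareFace (C true).1 (C false).1) (q : P0 T) :
    (∀ K : Fin 2 → wfCells T, IsBoundaryEdgeLabeling T e K → q (K 0) - q (K 1) = 0) ↔
    q (C true) = q (C false) := by
  constructor
  · intro h
    refine sub_eq_zero.1 (h ![C true, C false] ⟨?_, ?_, hs⟩)
    · have hne : C true ≠ C false := fun h => by simpa using hC h
      intro i j hij
      fin_cases i <;> fin_cases j <;> simp_all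
    · rw [← hr]
      ext L
      simp
  · rintro h K ⟨hK, hKr, -⟩
    have hx : ∀ j, ∃ x, C x = K j := fun j => by
      have : K j ∈ range C := by
        rw [hr, ← hKr]
        exact ⟨j, rfl⟩
      exact this
    obtain ⟨x, hx0⟩ := hx 0
    obtain ⟨y, hy1⟩ := hx 1
    rw [← hx0, ← hy1]
    cases x <;> cases y <;> simp [h]

/-- A vertex of a triangle lies on two of its edges. -/
theorem edge_eq_or_eq {f e₁ e₂ e : Finset 𝔼} (hf : f.card = 3) (h₁ : e₁ ⊆ f) (h₂ : e₂ ⊆ f)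
    (h : e ⊆ f) (c₁ : e₁.card = 2) (c₂ : e₂.card = 2) (c : e.card = 2) (hne : e₁ ≠ e₂) {a : 𝔼}
    (a₁ : a ∈ e₁) (a₂ : a ∈ e₂) (ha : a ∈ e) : e = e₁ ∨ e = e₂ := by
  classical
  obtain ⟨b₁, hb₁, rfl⟩ := exists_eq_pair c₁ a₁
  obtain ⟨b₂, hb₂, rfl⟩ := exists_eq_pair c₂ a₂
  obtain ⟨b, hb, rfl⟩ := exists_eq_pair c ha
  have hb12 : b₁ ≠ b₂ := fun h => hne (by rw [h])
  have hfe : {a, b₁, b₂} = f := Finset.eq_of_subset_of_card_le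
    (by
      intro x hx
      simp only [Finset.mem_insert, Finset.mem_singleton] at hx
      rcases hx with rfl | rfl | rfl
      · exact h₁ (by simp)
      · exact h₁ (by simp)
      · exact h₂ (by simp))
    (by rw [hf, Finset.card_eq_three.2 ⟨_, _, _, hb₁, hb₂, hb12, rfl⟩])
  have hbf : b ∈ f := h (by simp)
  rw [← hfe] at hbf
  simp only [Finset.mem_insert, Finset.mem_singleton] at hbf
  rcases hbf with rfl | rfl | rfl
  · exact absurd rfl hb
  · exact .inl rfl
  · exact .inr rfl

theorem exists_common_vertex {f e₁ e₂ : Finset 𝔼} (hf : f.card = 3) (h₁ : e₁ ⊆ f) (h₂ : e₂ ⊆ f)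
    (c₁ : e₁.card = 2) (c₂ : e₂.card = 2) : ∃ a, a ∈ e₁ ∧ a ∈ e₂ := by
  classical
  have hi := Finset.card_union_add_card_inter e₁ e₂
  have hu := Finset.card_le_card (Finset.union_subset h₁ h₂)
  have : 0 < (e₁ ∩ e₂).card := by omega
  obtain ⟨a, ha⟩ := Finset.card_pos.1 this
  exact ⟨a, Finset.mem_inter.1 ha⟩

/-- The constraint at the singular edge from the split point to a vertex `a` of an interior face:
`H i j` is the tetrahedron on the `i`-th side of the face at the `j`-th edge through `a`. -/
theorem interior_constraint_iff [DecidableEq 𝔼] {H : Bool → Bool → Flag T} {f : Finset 𝔼}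
    {z a : 𝔼} {t e : Bool → Finset 𝔼}
    (hz : IsInteriorSplitPoint T f z) (hHt : ∀ i j, (H i j).t = t i) (hHe : ∀ i j, (H i j).e = e j)
    (hHf : ∀ i j, (H i j).f = f)
    (ht : t true ≠ t false) (he : e true ≠ e false) (ha : ∀ j, a ∈ e j) (q : P0 T) :
    ((¬ IsBoundaryEdge T {z, a} → ∀ K : Fin 4 → wfCells T, IsInteriorEdgeLabeling T {z, a} K →
        q (K 0) - q (K 1) + q (K 2) - q (K 3) = 0) ∧
      (IsBoundaryEdge T {z, a} → ∀ K : Fin 2 → wfCells T, IsBoundaryEdgeLabeling T {z, a} K →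
        q (K 0) - q (K 1) = 0)) ↔
    q (H true true).tet - q (H false true).tet = q (H true false).tet - q (H false false).tet := by
  have hHz : ∀ i j, (H i j).z = z := fun i j => (H i j).hz.unique ((hHf i j).symm ▸ .inl hz)
  have haH : ∀ i j, a ∈ (H i j).e := fun i j => hHe i j ▸ ha j
  have hnb : ¬ IsBoundaryEdge T {z, a} := by
    rw [← hHz true true]
    exact Flag.not_isBoundaryEdge (by rwa [hHf, hHz]) (haH true true)
  have hinj : Function.Injective fun x : Bool × Bool => (H x.1 x.2).tet := by
    rintro ⟨i, j⟩ ⟨k, l⟩ h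
    obtain ⟨h1, -, h3⟩ := Flag.tet_eq_iff.1 h
    simp only [hHt, hHe] at h1 h3
    have : i = k := by cases i <;> cases k <;> simp_all
    have : j = l := by cases j <;> cases l <;> simp_all
    simp_all
  rw [and_iff_left (fun h => absurd h hnb), imp_iff_right hnb,
    forall_interiorEdgeLabeling_iff hinj ?_ ?_]
  · ext L
    obtain ⟨G, rfl⟩ := Flag.exists_tet_eq L
    constructor
    · rintro ⟨⟨i, j⟩, hG⟩
      rw [← hG, mem_ofPred_eq, ← hHz i j]
      exact (Flag.pair_subset_verts_iff (haH i j)).2 ⟨rfl, haH i j⟩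
    · intro hG
      rw [mem_ofPred_eq, ← hHz true true] at hG
      obtain ⟨hGf, haG⟩ := (Flag.pair_subset_verts_iff (haH true true)).1 hG
      rw [hHf] at hGf
      have hft : ∀ i, f ⊆ t i := fun i => hHf i true ▸ hHt i true ▸ (H i true).hft
      have hef : ∀ j, e j ⊆ f := fun j => hHf true j ▸ hHe true j ▸ (H true j).hef
      have htc : ∀ i, t i ∈ cells T := fun i => hHt i true ▸ (H i true).ht
      have hec : ∀ j, (e j).card = 2 := fun j => hHe true j ▸ (H true j).he
      have h1 : ∃ i, t i = G.t := by
        rcases eq_or_eq_of_common_face hz.1 (htc true) (htc false) G.ht (hft true) (hft false)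
          (hGf ▸ G.hft) ht with h | h
        · exact ⟨true, h.symm⟩
        · exact ⟨false, h.symm⟩
      have h2 : ∃ j, e j = G.e := by
        rcases edge_eq_or_eq hz.1 (hef true) (hef false) (hGf ▸ G.hef) (hec true) (hec false) G.he
          he (ha true) (ha false) haG with h | h
        · exact ⟨true, h.symm⟩
        · exact ⟨false, h.symm⟩
      obtain ⟨i, hi⟩ := h1
      obtain ⟨j, hj⟩ := h2
      exact ⟨(i, j), Flag.tet_eq_iff.2 ⟨(hHt i j).trans hi, (hHf i j).trans hGf,
        (hHe i j).trans hj⟩⟩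
  · rintro ⟨i, j⟩ ⟨k, l⟩ hne
    rw [Flag.shareFace_iff (by rw [hHf, hHf]) fun h => hne (hinj h)]
    simp only [hHt, hHe]
    have h1 : t i = t k ↔ i = k := by cases i <;> cases k <;> simp [ht, ht.symm]
    have h2 : e j = e l ↔ j = l := by cases j <;> cases l <;> simp [he, he.symm]
    rw [h1, h2]

/-- The constraint at the singular edge from the split point to a vertex `a` of a boundary face:
`H j` is the tetrahedron at the `j`-th edge through `a`. -/
theorem boundary_constraint_iff [DecidableEq 𝔼] {H : Bool → Flag T} {f : Finset 𝔼} {z a : 𝔼}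
    (hz : IsBoundarySplitPoint T f z) (hHf : ∀ j, (H j).f = f)
    (he : (H true).e ≠ (H false).e) (ha : ∀ j, a ∈ (H j).e) (q : P0 T) :
    ((¬ IsBoundaryEdge T {z, a} → ∀ K : Fin 4 → wfCells T, IsInteriorEdgeLabeling T {z, a} K →
        q (K 0) - q (K 1) + q (K 2) - q (K 3) = 0) ∧
      (IsBoundaryEdge T {z, a} → ∀ K : Fin 2 → wfCells T, IsBoundaryEdgeLabeling T {z, a} K →
        q (K 0) - q (K 1) = 0)) ↔
    q (H true).tet = q (H false).tet := by
  have hHz : ∀ j, (H j).z = z := fun j => (H j).hz.unique ((hHf j).symm ▸ .inr hz)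
  have ht : ∀ G : Flag T, G.f = f → G.t = (H true).t := fun G hG =>
    hz.2.1.unique ⟨G.ht, hG ▸ G.hft⟩ ⟨(H true).ht, hHf true ▸ (H true).hft⟩
  have hb : IsBoundaryEdge T {z, a} := by
    rw [← hHz true]
    exact Flag.isBoundaryEdge (by rwa [hHf, hHz]) (ha true)
  have hinj : Function.Injective fun j => (H j).tet := by
    intro i j h
    obtain ⟨-, -, h3⟩ := Flag.tet_eq_iff.1 h
    cases i <;> cases j <;> simp_all
  rw [and_iff_right (fun h => absurd hb h), imp_iff_right hb,
    forall_boundaryEdgeLabeling_iff hinj ?_ ?_]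
  · ext L
    obtain ⟨G, rfl⟩ := Flag.exists_tet_eq L
    constructor
    · rintro ⟨j, hG⟩
      rw [← hG, mem_ofPred_eq, ← hHz j]
      exact (Flag.pair_subset_verts_iff (ha j)).2 ⟨rfl, ha j⟩
    · intro hG
      rw [mem_ofPred_eq, ← hHz true] at hG
      obtain ⟨hGf, haG⟩ := (Flag.pair_subset_verts_iff (ha true)).1 hG
      rw [hHf] at hGf
      have h2 : ∃ j, (H j).e = G.e := by
        rcases edge_eq_or_eq hz.1 (hHf true ▸ (H true).hef) (hHf false ▸ (H false).hef)
          (hGf ▸ G.hef) (H true).he (H false).he G.he he (ha true) (ha false) haG with h | h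
        · exact ⟨true, h.symm⟩
        · exact ⟨false, h.symm⟩
      obtain ⟨j, hj⟩ := h2
      exact ⟨j, Flag.tet_eq_iff.2 ⟨(ht _ (hHf j)).trans (ht _ hGf.symm).symm,
        (hHf j).trans hGf, hj⟩⟩
  · have hne : (H true).tet ≠ (H false).tet := fun h => by simpa using hinj h
    exact (Flag.shareFace_iff (by rw [hHf, hHf]) hne).2 (.inl (ht _ (hHf false)).symm)

/-! ### Labelings -/

/-- The three edges of a triangle. -/
theorem exists_edges {f : Finset 𝔼} (hf : f.card = 3) :
    ∃ ε : Fin 3 → Finset 𝔼, Function.Injective ε ∧ (∀ j, ε j ⊆ f ∧ (ε j).card = 2) ∧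
      ∀ e ⊆ f, e.card = 2 → ∃ j, ε j = e := by
  have hc : (f.powersetCard 2).card = 3 := by
    rw [Finset.card_powersetCard, hf]
    rfl
  let E := (Finset.equivFinOfCardEq hc).symm
  refine ⟨fun j => (E j).1, fun i j h => E.injective (Subtype.ext h),
    fun j => Finset.mem_powersetCard.1 (E j).2, fun e he hec => ?_⟩
  refine ⟨E.symm ⟨e, Finset.mem_powersetCard.2 ⟨he, hec⟩⟩, ?_⟩
  exact congrArg Subtype.val (E.apply_symm_apply _)

/-- The tetrahedra in one tetrahedron `t` of `T` at the split point of a face of `t`. -/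
theorem exists_flags {f t : Finset 𝔼} {z : 𝔼} {ε : Fin 3 → Finset 𝔼} (ht : t ∈ cells T)
    (hft : f ⊆ t) (hz : IsSplitPoint T f z) (hε : ∀ j, ε j ⊆ f ∧ (ε j).card = 2) :
    ∃ H : Fin 3 → Flag T, ∀ j, (H j).t = t ∧ (H j).f = f ∧ (H j).z = z ∧ (H j).e = ε j :=
  ⟨fun j => ⟨t, f, z, ε j, ht, hft, hz, (hε j).1, (hε j).2⟩, fun _ => ⟨rfl, rfl, rfl, rfl⟩⟩

theorem Flag.hull_subset (G : Flag T) : hull G.tet.1 ⊆ hull G.t := by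
  refine convexHull_min (fun x hx => ?_) (convex_convexHull ℝ _)
  rcases Flag.mem_verts.1 hx with rfl | rfl | hx
  · exact (inOpenSimplex_incenter G.ht).mem_convexHull
  · exact convexHull_mono (by exact_mod_cast G.hft) G.hz.inOpenSimplex.mem_convexHull
  · exact subset_convexHull ℝ _ (G.hft (G.hef hx))

/-- A tetrahedron of the refinement lies in only one tetrahedron of `T`. -/
theorem Flag.t_eq_of_hull_subset {G : Flag T} {t : Finset 𝔼} (ht : t ∈ cells T)
    (h : hull G.tet.1 ⊆ hull t) : G.t = t := by
  have hc : incenter G.t ∈ hull t := h (subset_convexHull ℝ _ (Flag.mem_verts.2 (.inl rfl)))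
  exact Finset.eq_of_subset_of_card_le
    ((inOpenSimplex_incenter G.ht).subset_of_mem_convexHull G.ht.1 ht.1 hc) (by rw [ht.2, G.ht.2])

/-- At an interior split point the tetrahedra can be labeled admissibly: those on one side of the
face in the order of its edges, and then those on the other side in the same order. -/
theorem exists_inner (z : interiorSplitPoints T) : ∃ K : Fin 6 → wfCells T,
    Function.Injective K ∧ range K = {K | z.1 ∈ K.1} ∧
    (∃ t₁ ∈ cells T, ∃ t₂ ∈ cells T, ∀ j : Fin 3,
      hull (K (Fin.castAdd 3 j)).1 ⊆ hull t₁ ∧ hull (K (Fin.natAdd 3 j)).1 ⊆ hull t₂) ∧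
    ∀ j : Fin 3, ShareFace (K (Fin.castAdd 3 j)).1 (K (Fin.natAdd 3 j)).1 := by
  classical
  obtain ⟨z, f, hz⟩ := z
  obtain ⟨t₁, ht₁, t₂, ht₂, hne, h₁, h₂, hu, -⟩ := hz.exists_cells
  obtain ⟨ε, hεi, hε, hεs⟩ := exists_edges hz.1
  obtain ⟨G, hG⟩ := exists_flags ht₁ h₁ (.inl hz) hε
  obtain ⟨H, hH⟩ := exists_flags ht₂ h₂ (.inl hz) hε
  have hGi : Function.Injective fun j => (G j).tet := fun i j h => hεi (by
    rw [← (hG i).2.2.2, ← (hG j).2.2.2]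
    exact (Flag.tet_eq_iff.1 h).2.2)
  have hHi : Function.Injective fun j => (H j).tet := fun i j h => hεi (by
    rw [← (hH i).2.2.2, ← (hH j).2.2.2]
    exact (Flag.tet_eq_iff.1 h).2.2)
  have hGH : ∀ i j, (G i).tet ≠ (H j).tet := fun i j h => hne (by
    rw [← (hG i).1, ← (hH j).1]
    exact (Flag.tet_eq_iff.1 h).1)
  have hl : ∀ j : Fin 3, (Fin.append (fun j => (G j).tet) (fun j => (H j).tet) : Fin 6 → wfCells T)
      (Fin.castAdd 3 j) = (G j).tet := Fin.append_left _ _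
  have hr : ∀ j : Fin 3, (Fin.append (fun j => (G j).tet) (fun j => (H j).tet) : Fin 6 → wfCells T)
      (Fin.natAdd 3 j) = (H j).tet := Fin.append_right _ _
  refine ⟨Fin.append (fun j => (G j).tet) (fun j => (H j).tet), ?_, ?_,
    ⟨t₁, ht₁, t₂, ht₂, fun j => ⟨?_, ?_⟩⟩, fun j => ?_⟩
  · exact Fin.append_injective_iff.2 ⟨hGi, hHi, hGH⟩
  · ext L
    obtain ⟨F, rfl⟩ := Flag.exists_tet_eq L
    have hmem : z ∈ F.tet.1 ↔ f = F.f := Flag.splitPoint_mem_verts (.inl hz)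
    rw [mem_ofPred_eq, hmem]
    constructor
    · rintro ⟨m, hm⟩
      refine Fin.addCases (m := 3) (n := 3) (fun j hm => ?_) (fun j hm => ?_) m hm
      · rw [hl] at hm
        rw [← (hG j).2.1, (Flag.tet_eq_iff.1 hm).2.1]
      · rw [hr] at hm
        rw [← (hH j).2.1, (Flag.tet_eq_iff.1 hm).2.1]
    · intro hf
      obtain ⟨j, hj⟩ := hεs F.e (hf ▸ F.hef) F.he
      rcases hu F.t F.ht (hf ▸ F.hft) with ht | ht
      · refine ⟨Fin.castAdd 3 j, (hl j).trans (Flag.tet_eq_iff.2 ⟨?_, ?_, ?_⟩)⟩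
        · rw [(hG j).1, ht]
        · rw [(hG j).2.1, hf]
        · rw [(hG j).2.2.2, hj]
      · refine ⟨Fin.natAdd 3 j, (hr j).trans (Flag.tet_eq_iff.2 ⟨?_, ?_, ?_⟩)⟩
        · rw [(hH j).1, ht]
        · rw [(hH j).2.1, hf]
        · rw [(hH j).2.2.2, hj]
  · rw [hl, ← (hG j).1]
    exact (G j).hull_subset
  · rw [hr, ← (hH j).1]
    exact (H j).hull_subset
  · rw [hl, hr, Flag.shareFace_iff (by rw [(hG j).2.1, (hH j).2.1]) (hGH j j)]
    right
    rw [(hG j).2.2.2, (hH j).2.2.2]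

theorem exists_outer (z : boundarySplitPoints T) : ∃ K : Fin 3 → wfCells T,
    Function.Injective K ∧ range K = {K | z.1 ∈ K.1} := by
  classical
  obtain ⟨z, f, hz⟩ := z
  obtain ⟨t, ⟨ht, hft⟩, hu⟩ := hz.2.1
  obtain ⟨ε, hεi, hε, hεs⟩ := exists_edges hz.1
  obtain ⟨G, hG⟩ := exists_flags ht hft (.inr hz) hε
  refine ⟨fun j => (G j).tet, fun i j h => hεi ?_, ?_⟩
  · rw [← (hG i).2.2.2, ← (hG j).2.2.2]
    exact (Flag.tet_eq_iff.1 h).2.2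
  · ext L
    obtain ⟨F, rfl⟩ := Flag.exists_tet_eq L
    have hmem : z ∈ F.tet.1 ↔ f = F.f := Flag.splitPoint_mem_verts (.inr hz)
    rw [mem_ofPred_eq, hmem]
    constructor
    · rintro ⟨j, hm⟩
      rw [← (hG j).2.1, (Flag.tet_eq_iff.1 hm).2.1]
    · intro hf
      obtain ⟨j, hj⟩ := hεs F.e (hf ▸ F.hef) F.he
      refine ⟨j, Flag.tet_eq_iff.2 ⟨?_, ?_, ?_⟩⟩
      · rw [(hG j).1, hu F.t ⟨F.ht, hf ▸ F.hft⟩]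
      · rw [(hG j).2.1, hf]
      · rw [(hG j).2.2.2, hj]

theorem nonempty_labeling : Nonempty (Labeling T) := by
  choose K hK using exists_inner (T := T)
  choose L hL using exists_outer (T := T)
  exact ⟨⟨K, fun z => (hK z).1, fun z => (hK z).2.1, fun z => (hK z).2.2.1,
    fun z => (hK z).2.2.2, L, fun z => (hL z).1, fun z => (hL z).2⟩⟩

theorem splitPoint_unique {K : wfCells T} {f f' : Finset 𝔼} {z z' : 𝔼} (hz : IsSplitPoint T f z)
    (hz' : IsSplitPoint T f' z') (h : z ∈ K.1) (h' : z' ∈ K.1) : f = f' ∧ z = z' := by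
  obtain ⟨G, rfl⟩ := Flag.exists_tet_eq K
  obtain rfl : f = f' := ((Flag.splitPoint_mem_verts hz).1 h).trans
    ((Flag.splitPoint_mem_verts hz').1 h').symm
  exact ⟨rfl, hz.unique hz'⟩

theorem not_interior_and_boundary {f : Finset 𝔼} {z z' : 𝔼} (hz : IsInteriorSplitPoint T f z)
    (hz' : IsBoundarySplitPoint T f z') : False := by
  obtain ⟨-, t₁, ht₁, t₂, ht₂, hne, h₁, h₂, -⟩ := hz
  exact not_isBoundarySplitPoint_of_ne ht₁ ht₂ h₁ h₂ hne hz'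

namespace Labeling

variable (lab : Labeling T)

theorem mem_inner (z : interiorSplitPoints T) (j : Fin 6) : z.1 ∈ (lab.inner z j).1 :=
  (lab.range_inner z).subset ⟨j, rfl⟩

theorem mem_outer (z : boundarySplitPoints T) (j : Fin 3) : z.1 ∈ (lab.outer z j).1 :=
  (lab.range_outer z).subset ⟨j, rfl⟩

theorem cell_injective : Function.Injective lab.cell := by
  rintro (⟨⟨z, f, hz⟩, j⟩ | ⟨⟨z, f, hz⟩, j⟩) (⟨⟨z', f', hz'⟩, j'⟩ | ⟨⟨z', f', hz'⟩, j'⟩) h <;>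
    simp only [cell] at h
  · obtain ⟨-, rfl⟩ := splitPoint_unique (.inl hz) (.inl hz') (lab.mem_inner _ j)
      (h ▸ lab.mem_inner _ j')
    rw [lab.inner_injective _ h]
  · obtain ⟨rfl, -⟩ := splitPoint_unique (.inl hz) (.inr hz') (lab.mem_inner _ j)
      (h ▸ lab.mem_outer _ j')
    exact (not_interior_and_boundary hz hz').elim
  · obtain ⟨rfl, -⟩ := splitPoint_unique (.inr hz) (.inl hz') (lab.mem_outer _ j)
      (h ▸ lab.mem_inner _ j')
    exact (not_interior_and_boundary hz' hz).elim
  · obtain ⟨-, rfl⟩ := splitPoint_unique (.inr hz) (.inr hz') (lab.mem_outer _ j)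
      (h ▸ lab.mem_outer _ j')
    rw [lab.outer_injective _ h]

theorem cell_surjective : Function.Surjective lab.cell := by
  intro K
  obtain ⟨G, rfl⟩ := Flag.exists_tet_eq K
  have hm : G.z ∈ G.tet.1 := Flag.mem_verts.2 (.inr (.inl rfl))
  rcases G.hz with hz | hz
  · obtain ⟨j, hj⟩ := (lab.range_inner ⟨G.z, G.f, hz⟩).superset hm
    exact ⟨.inl (_, j), hj⟩
  · obtain ⟨j, hj⟩ := (lab.range_outer ⟨G.z, G.f, hz⟩).superset hm
    exact ⟨.inr (_, j), hj⟩

theorem cell_bijective : Function.Bijective lab.cell := ⟨lab.cell_injective, lab.cell_surjective⟩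

/-- Two tetrahedra at an interior split point whose labels differ by three are mirror images: they
belong to the same edge of the face, on different sides of it. -/
theorem exists_inner_flags {f : Finset 𝔼} {z : 𝔼} (hz : IsInteriorSplitPoint T f z) :
    ∃ (H : Bool → Fin 3 → Flag T) (t : Bool → Finset 𝔼) (ε : Fin 3 → Finset 𝔼),
      t true ≠ t false ∧ Function.Injective ε ∧
      (∀ i j, (H i j).t = t i ∧ (H i j).f = f ∧ (H i j).e = ε j) ∧
      (∀ j, (H true j).tet = lab.inner ⟨z, f, hz⟩ (Fin.castAdd 3 j)) ∧
      ∀ j, (H false j).tet = lab.inner ⟨z, f, hz⟩ (Fin.natAdd 3 j) := by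
  classical
  choose H hH using fun m => Flag.exists_tet_eq (lab.inner ⟨z, f, hz⟩ m)
  have hHf : ∀ m, (H m).f = f := fun m => by
    have := lab.mem_inner ⟨z, f, hz⟩ m
    rw [← hH] at this
    exact ((Flag.splitPoint_mem_verts (.inl hz)).1 this).symm
  obtain ⟨t₁, ht₁, t₂, ht₂, hsub⟩ := lab.inner_subset ⟨z, f, hz⟩
  have h1 : ∀ j : Fin 3, (H (Fin.castAdd 3 j)).t = t₁ := fun j =>
    Flag.t_eq_of_hull_subset ht₁ (by rw [hH]; exact (hsub j).1)
  have h2 : ∀ j : Fin 3, (H (Fin.natAdd 3 j)).t = t₂ := fun j =>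
    Flag.t_eq_of_hull_subset ht₂ (by rw [hH]; exact (hsub j).2)
  have hne : t₁ ≠ t₂ := by
    -- all tetrahedra at `z` are labeled, on both sides of the face
    rintro rfl
    have hall : ∀ m, (H m).t = t₁ := Fin.addCases (m := 3) (n := 3) h1 h2
    obtain ⟨s₁, hs₁, s₂, hs₂, hs, hf₁, hf₂, -⟩ := hz.exists_cells
    have hcov : ∀ s ∈ cells T, f ⊆ s → s = t₁ := by
      intro s hs hfs
      let G := (H 0).withCell s hs (by rw [hHf]; exact hfs)
      have hG : z ∈ G.tet.1 := (Flag.splitPoint_mem_verts (.inl hz)).2 (hHf 0).symm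
      obtain ⟨m, hm⟩ := (lab.range_inner ⟨z, f, hz⟩).superset hG
      rw [← hH] at hm
      rw [← hall m, (Flag.tet_eq_iff.1 hm).1]
      rfl
    exact hs ((hcov s₁ hs₁ hf₁).trans (hcov s₂ hs₂ hf₂).symm)
  have hee : ∀ j : Fin 3, (H (Fin.castAdd 3 j)).e = (H (Fin.natAdd 3 j)).e := by
    intro j
    have hs := lab.inner_shareFace ⟨z, f, hz⟩ j
    rw [← hH, ← hH, Flag.shareFace_iff (by rw [hHf, hHf])] at hs
    · refine hs.resolve_left ?_
      rw [h1, h2]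
      exact hne
    · rintro h
      apply hne
      rw [← h1 j, (Flag.tet_eq_iff.1 h).1, h2]
  refine ⟨fun i j => if i then H (Fin.castAdd 3 j) else H (Fin.natAdd 3 j),
    fun i => if i then t₁ else t₂, fun j => (H (Fin.castAdd 3 j)).e, by simpa, ?_, ?_,
    fun j => by simp [hH], fun j => by simp [hH]⟩
  · intro i j h
    have h' : (H (Fin.castAdd 3 i)).tet = (H (Fin.castAdd 3 j)).tet :=
      Flag.tet_eq_iff.2 ⟨by rw [h1, h1], by rw [hHf, hHf], h⟩
    rw [hH, hH] at h'
    exact Fin.castAdd_injective _ _ (lab.inner_injective _ h')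
  · rintro (_ | _) j
    · exact ⟨h2 j, hHf _, (hee j).symm⟩
    · exact ⟨h1 j, hHf _, rfl⟩

theorem exists_outer_flags {f : Finset 𝔼} {z : 𝔼} (hz : IsBoundarySplitPoint T f z) :
    ∃ H : Fin 3 → Flag T, Function.Injective (fun j => (H j).e) ∧ (∀ j, (H j).f = f) ∧
      ∀ j, (H j).tet = lab.outer ⟨z, f, hz⟩ j := by
  choose H hH using fun m => Flag.exists_tet_eq (lab.outer ⟨z, f, hz⟩ m)
  have hHf : ∀ m, (H m).f = f := fun m => by
    have := lab.mem_outer ⟨z, f, hz⟩ m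
    rw [← hH] at this
    exact ((Flag.splitPoint_mem_verts (.inr hz)).1 this).symm
  refine ⟨H, fun i j h => ?_, hHf, hH⟩
  apply lab.outer_injective
  rw [← hH, ← hH]
  exact Flag.tet_eq_iff.2 ⟨hz.2.1.unique ⟨(H i).ht, hHf i ▸ (H i).hft⟩
    ⟨(H j).ht, hHf j ▸ (H j).hft⟩, by rw [hHf, hHf], h⟩

/-- In terms of a labeling, membership in the pressure space means that the jump across an interior
face is the same at its three edges, and that the values at a boundary face agree. -/
theorem mem_pressureSpace_iff (q : P0 T) : q ∈ pressureSpace T ↔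
    (∀ z, ∀ i j : Fin 3, q (lab.inner z (Fin.castAdd 3 i)) - q (lab.inner z (Fin.natAdd 3 i)) =
      q (lab.inner z (Fin.castAdd 3 j)) - q (lab.inner z (Fin.natAdd 3 j))) ∧
    ∀ z, ∀ i j : Fin 3, q (lab.outer z i) = q (lab.outer z j) := by
  classical
  constructor
  · intro hq
    constructor
    · rintro ⟨z, f, hz⟩ i j
      obtain ⟨H, t, ε, ht, hε, hHd, hin, hout⟩ := lab.exists_inner_flags hz
      by_cases hij : i = j
      · rw [hij]
      have hcom : ∃ a, a ∈ ε i ∧ a ∈ ε j := by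
        rw [← (hHd true i).2.2, ← (hHd true j).2.2]
        exact exists_common_vertex hz.1 ((hHd true i).2.1 ▸ (H true i).hef)
          ((hHd true j).2.1 ▸ (H true j).hef) (H true i).he (H true j).he
      obtain ⟨a, hai, haj⟩ := hcom
      have haH : a ∈ (H true i).e := by rwa [(hHd true i).2.2]
      have hzz : (H true i).z = z := (H true i).hz.unique ((hHd true i).2.1.symm ▸ .inl hz)
      have hs := Flag.pair_mem_singularEdges haH
      rw [hzz] at hs
      have := (interior_constraint_iff (H := fun b c => H b (if c then i else j)) (t := t)
        (e := fun c => ε (if c then i else j)) hz (fun b c => (hHd _ _).1)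
        (fun b c => (hHd _ _).2.2) (fun b c => (hHd _ _).2.1) ht
        (by simpa using fun h => hij (hε h)) (by simp [hai, haj]) q).1 (hq _ hs)
      simpa [hin, hout] using this
    · rintro ⟨z, f, hz⟩ i j
      obtain ⟨H, hHi, hHf, hH⟩ := lab.exists_outer_flags hz
      by_cases hij : i = j
      · rw [hij]
      obtain ⟨a, hai, haj⟩ := exists_common_vertex hz.1 (hHf i ▸ (H i).hef) (hHf j ▸ (H j).hef)
        (H i).he (H j).he
      have hzz : (H i).z = z := (H i).hz.unique ((hHf i).symm ▸ .inr hz)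
      have hs := Flag.pair_mem_singularEdges hai
      rw [hzz] at hs
      have := (boundary_constraint_iff (H := fun c => H (if c then i else j)) hz
        (fun c => hHf _) (by simpa using fun h => hij (hHi h)) (by simp [hai, haj]) q).1 (hq _ hs)
      simpa [hH] using this
  · rintro ⟨hi, ho⟩ e he
    obtain ⟨G, a, ha, rfl⟩ := exists_eq_of_mem_singularEdges he
    -- the two edges of the face through `a`
    obtain ⟨b, hab, heb⟩ := exists_eq_pair G.he ha
    obtain ⟨d, hd, hfd⟩ := G.exists_third_vertex
    have hda : a ≠ d := fun h => hd (h ▸ ha)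
    let G' := G.withEdge {a, d} (by
      rw [hfd, heb]
      intro x
      simp
      tauto) (Finset.card_pair hda)
    have haG' : a ∈ G'.e := by simp [G', Flag.withEdge]
    have hne : G.e ≠ G'.e := fun h => hd (h ▸ by simp [G', Flag.withEdge])
    rcases G.hz with hz | hz
    · obtain ⟨H, t, ε, ht, hε, hHd, hin, hout⟩ := lab.exists_inner_flags hz
      have hcov : ∀ F : Flag T, F.f = G.f → ∃ k, ε k = F.e := by
        intro F hF
        have hm : G.z ∈ F.tet.1 := (Flag.splitPoint_mem_verts (.inl hz)).2 hF.symm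
        obtain ⟨m, hm⟩ := (lab.range_inner ⟨G.z, G.f, hz⟩).superset hm
        refine Fin.addCases (m := 3) (n := 3) (fun j hm => ?_) (fun j hm => ?_) m hm
        · rw [← hin] at hm
          exact ⟨j, by rw [← (hHd true j).2.2, (Flag.tet_eq_iff.1 hm).2.2]⟩
        · rw [← hout] at hm
          exact ⟨j, by rw [← (hHd false j).2.2, (Flag.tet_eq_iff.1 hm).2.2]⟩
      obtain ⟨i, hi'⟩ := hcov G rfl
      obtain ⟨j, hj'⟩ := hcov G' rfl
      refine (interior_constraint_iff (H := fun b c => H b (if c then i else j)) (t := t)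
        (e := fun c => ε (if c then i else j)) hz (fun b c => (hHd _ _).1)
        (fun b c => (hHd _ _).2.2) (fun b c => (hHd _ _).2.1) ht
        (by simpa [hi', hj'] using hne) (by simp [hi', hj', ha, haG']) q).2 ?_
      have := hi ⟨G.z, G.f, hz⟩ i j
      simpa [hin, hout] using this
    · obtain ⟨H, hHi, hHf, hH⟩ := lab.exists_outer_flags hz
      have hcov : ∀ F : Flag T, F.f = G.f → ∃ k, (H k).e = F.e := by
        intro F hF
        have hm : G.z ∈ F.tet.1 := (Flag.splitPoint_mem_verts (.inr hz)).2 hF.symm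
        obtain ⟨m, hm⟩ := (lab.range_outer ⟨G.z, G.f, hz⟩).superset hm
        rw [← hH] at hm
        exact ⟨m, (Flag.tet_eq_iff.1 hm).2.2⟩
      obtain ⟨i, hi'⟩ := hcov G rfl
      obtain ⟨j, hj'⟩ := hcov G' rfl
      refine (boundary_constraint_iff (H := fun c => H (if c then i else j)) hz
        (fun c => hHf _) (by simpa [hi', hj'] using hne) (by simp [hi', hj', ha, haG']) q).2 ?_
      have := ho ⟨G.z, G.f, hz⟩ i j
      simpa [hH] using this

end Labeling

/-! ### The basis of the pressure space -/

theorem finite_interiorSplitPoints (hT : IsTetrahedral T) : Finite (interiorSplitPoints T) := by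
  have := hT.1.to_subtype
  choose f hf using fun z : interiorSplitPoints T => z.2
  refine Finite.of_injective
    (fun z => (⟨f z, IsSplitPoint.mem_faces (.inl (hf z))⟩ : T.faces)) fun z z' h => ?_
  have h' : f z = f z' := congrArg Subtype.val h
  exact Subtype.ext (IsSplitPoint.unique (.inl (hf z)) (h' ▸ .inl (hf z')))

theorem finite_boundarySplitPoints (hT : IsTetrahedral T) : Finite (boundarySplitPoints T) := by
  have := hT.1.to_subtype
  choose f hf using fun z : boundarySplitPoints T => z.2
  refine Finite.of_injective
    (fun z => (⟨f z, IsSplitPoint.mem_faces (.inr (hf z))⟩ : T.faces)) fun z z' h => ?_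
  have h' : f z = f z' := congrArg Subtype.val h
  exact Subtype.ext (IsSplitPoint.unique (.inr (hf z)) (h' ▸ .inr (hf z')))

namespace Labeling

variable (lab : Labeling T)

theorem mem_pressureSpace_iff_values (q : P0 T) : q ∈ pressureSpace T ↔
    (∀ z, q (lab.inner z 0) - q (lab.inner z 3) = q (lab.inner z 2) - q (lab.inner z 5) ∧
      q (lab.inner z 1) - q (lab.inner z 4) = q (lab.inner z 2) - q (lab.inner z 5)) ∧
    ∀ z, q (lab.outer z 0) = q (lab.outer z 2) ∧ q (lab.outer z 1) = q (lab.outer z 2) := by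
  rw [lab.mem_pressureSpace_iff]
  refine and_congr (forall_congr' fun z => ⟨fun h => ⟨h 0 2, h 1 2⟩, fun h => ?_⟩)
    (forall_congr' fun z => ⟨fun h => ⟨h 0 2, h 1 2⟩, fun h => ?_⟩)
  · have key : ∀ i : Fin 3, q (lab.inner z (Fin.castAdd 3 i)) - q (lab.inner z (Fin.natAdd 3 i)) =
        q (lab.inner z 2) - q (lab.inner z 5) := by
      intro i
      fin_cases i
      exacts [h.1, h.2, rfl]
    intro i j
    rw [key i, key j]
  · have key : ∀ i : Fin 3, q (lab.outer z i) = q (lab.outer z 2) := by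
      intro i
      fin_cases i
      exacts [h.1, h.2, rfl]
    intro i j
    rw [key i, key j]

open scoped Classical in
theorem phi_apply_cell (c d : Label T) : lab.phi c (lab.cell d) = if d = c then 1 else 0 := by
  rw [phi, Pi.single_apply]
  simp only [lab.cell_injective.eq_iff]

theorem psi_mem (i : BasisLabel T) : lab.psi i ∈ pressureSpace T := by
  classical
  have hi : ∀ c z j, lab.phi c (lab.inner z j) = if (.inl (z, j) : Label T) = c then 1 else 0 :=
    fun c z j => lab.phi_apply_cell c (.inl (z, j))
  have ho : ∀ c z j, lab.phi c (lab.outer z j) = if (.inr (z, j) : Label T) = c then 1 else 0 :=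
    fun c z j => lab.phi_apply_cell c (.inr (z, j))
  rw [lab.mem_pressureSpace_iff_values]
  rcases i with ⟨z₀, k⟩ | z₀
  · refine ⟨fun z => ?_, fun z => ?_⟩
    · by_cases hz : z = z₀
      · fin_cases k <;> simp [psi, hi, hz]
      · fin_cases k <;> simp [psi, hi, hz]
    · fin_cases k <;> simp [psi, ho]
  · refine ⟨fun z => ?_, fun z => ?_⟩
    · simp [psi, hi]
    · by_cases hz : z = z₀ <;> simp [psi, ho, hz]

open scoped Classical in
/-- `psi i` involves only one of the tetrahedra with a basis label. -/
theorem psi_apply_cell_toLabel (i k : BasisLabel T) :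
    lab.psi i (lab.cell k.toLabel) = if k = i then 1 else 0 := by
  rcases i with ⟨z, m⟩ | z <;> rcases k with ⟨z', n⟩ | z'
  · by_cases hz : z' = z
    · fin_cases m <;> fin_cases n <;> simp [psi, BasisLabel.toLabel, phi_apply_cell, hz]
    · fin_cases m <;> simp [psi, BasisLabel.toLabel, phi_apply_cell, hz]
  · fin_cases m <;> simp [psi, BasisLabel.toLabel, phi_apply_cell]
  · simp [psi, BasisLabel.toLabel, phi_apply_cell]
  · by_cases hz : z' = z <;> simp [psi, BasisLabel.toLabel, phi_apply_cell, hz]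

/-- The values at the basis labels, as coordinates on the pressure space. -/
def restrict : pressureSpace T →ₗ[ℝ] (BasisLabel T → ℝ) where
  toFun q k := q.1 (lab.cell k.toLabel)
  map_add' _ _ := rfl
  map_smul' _ _ := rfl

theorem restrict_injective : Function.Injective lab.restrict := by
  refine (injective_iff_map_eq_zero _).2 fun q hq => ?_
  have h : ∀ k : BasisLabel T, q.1 (lab.cell k.toLabel) = 0 := congrFun hq
  have hi : ∀ z, ∀ m : Fin 4, q.1 (lab.inner z (Fin.natAdd 2 m)) = 0 := fun z m => h (.inl (z, m))
  have ho : ∀ z, q.1 (lab.outer z 2) = 0 := fun z => h (.inr z)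
  obtain ⟨hqi, hqo⟩ := (lab.mem_pressureSpace_iff_values q.1).1 q.2
  apply Subtype.ext
  funext K
  obtain ⟨c, rfl⟩ := lab.cell_surjective K
  rcases c with ⟨z, m⟩ | ⟨z, m⟩
  · have h2 : q.1 (lab.inner z 2) = 0 := hi z 0
    have h3 : q.1 (lab.inner z 3) = 0 := hi z 1
    have h4 : q.1 (lab.inner z 4) = 0 := hi z 2
    have h5 : q.1 (lab.inner z 5) = 0 := hi z 3
    obtain ⟨h03, h14⟩ := hqi z
    have h0 : q.1 (lab.inner z 0) = 0 := by linarith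
    have h1 : q.1 (lab.inner z 1) = 0 := by linarith
    fin_cases m
    exacts [h0, h1, h2, h3, h4, h5]
  · have h2 := ho z
    obtain ⟨h02, h12⟩ := hqo z
    fin_cases m
    exacts [h02.trans h2, h12.trans h2, h2]

open scoped Classical in
theorem restrict_psi (i : BasisLabel T) :
    lab.restrict ⟨lab.psi i, lab.psi_mem i⟩ = Pi.single i 1 := by
  funext k
  rw [Pi.single_apply, ← lab.psi_apply_cell_toLabel]
  rfl

theorem exists_basis (hT : IsTetrahedral T) :
    ∃ b : Module.Basis (BasisLabel T) ℝ (pressureSpace T), ∀ i, (b i : P0 T) = lab.psi i := by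
  classical
  have := finite_interiorSplitPoints hT
  have := finite_boundarySplitPoints hT
  have : Fintype (BasisLabel T) := Fintype.ofFinite _
  have hsurj : Function.Surjective lab.restrict := by
    intro v
    refine ⟨∑ i, v i • ⟨lab.psi i, lab.psi_mem i⟩, ?_⟩
    rw [map_sum]
    simp only [map_smul, restrict_psi]
    exact (pi_eq_sum_univ' v).symm
  have hbij : Function.Bijective lab.restrict := ⟨lab.restrict_injective, hsurj⟩
  refine ⟨Module.Basis.ofEquivFun (LinearEquiv.ofBijective lab.restrict hbij), fun i => ?_⟩
  have h : (LinearEquiv.ofBijective lab.restrict hbij).symm (Pi.single i 1) =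
      ⟨lab.psi i, lab.psi_mem i⟩ := by
    rw [LinearEquiv.symm_apply_eq, LinearEquiv.ofBijective_apply, restrict_psi]
  have h' : Module.Basis.ofEquivFun (LinearEquiv.ofBijective lab.restrict hbij) i =
      (LinearEquiv.ofBijective lab.restrict hbij).symm (Pi.single i 1) := by
    rw [Module.Basis.coe_ofEquivFun]
  rw [h', h]

end Labeling

/-! ### The Stokes matrices -/

theorem finite_wfCells (lab : Labeling T) (hT : IsTetrahedral T) : Finite (wfCells T) := by
  have := finite_interiorSplitPoints hT
  have := finite_boundarySplitPoints hT
  exact Finite.of_surjective lab.cell lab.cell_surjective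

theorem P0.toFun_add [Finite (wfCells T)] (p q : P0 T) (x : 𝔼) :
    P0.toFun T (p + q) x = P0.toFun T p x + P0.toFun T q x := by
  rw [P0.toFun, P0.toFun, P0.toFun, ← finsum_add_distrib (toFinite _) (toFinite _)]
  refine finsum_congr fun K => ?_
  by_cases hx : x ∈ interior (hull K.1) <;> simp [hx]

theorem P0.toFun_sub [Finite (wfCells T)] (p q : P0 T) (x : 𝔼) :
    P0.toFun T (p - q) x = P0.toFun T p x - P0.toFun T q x := by
  rw [P0.toFun, P0.toFun, P0.toFun, ← finsum_sub_distrib (toFinite _) (toFinite _)]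
  refine finsum_congr fun K => ?_
  by_cases hx : x ∈ interior (hull K.1) <;> simp [hx]

/-- The divergence of a velocity is constant inside every tetrahedron of the refinement, so its
product with a piecewise constant is integrable. -/
theorem integrable_divergence_mul_toFun [Finite (wfCells T)]
    {v : EuclideanSpace ℝ (Fin 3) → EuclideanSpace ℝ (Fin 3)} (hv : v ∈ velocitySpace T)
    (q : P0 T) :
    Integrable (fun x => divergence v x * P0.toFun T q x) (volume.restrict (domain T)) := by
  have := Fintype.ofFinite (wfCells T)
  have hsum : (fun x => divergence v x * P0.toFun T q x) = fun x =>
      ∑ K : wfCells T, divergence v x * (interior (hull K.1)).indicator (fun _ => q K) x := by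
    funext x
    rw [P0.toFun, finsum_eq_sum_of_fintype, Finset.mul_sum]
  rw [hsum]
  refine integrable_finsetSum _ fun K _ => ?_
  obtain ⟨A, hA⟩ := hv.2.2 _ K.2
  set U := interior (hull K.1)
  have hU : volume U < ⊤ := by
    refine (measure_mono interior_subset).trans_lt (IsCompact.measure_lt_top ?_)
    exact Set.Finite.isCompact_convexHull (𝕜 := ℝ) (Finset.finite_toSet K.1)
  have hfd : ∀ x ∈ U, fderiv ℝ v x = A.linear.toContinuousLinearMap := by
    intro x hx
    have hEq : v =ᶠ[nhds x] fun y => A.linear.toContinuousLinearMap y + A 0 := by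
      filter_upwards [isOpen_interior.mem_nhds hx] with y hy
      rw [hA y (interior_subset hy)]
      exact congrFun A.decomp y
    exact ((A.linear.toContinuousLinearMap.hasFDerivAt.add_const
      (A 0)).congr_of_eventuallyEq hEq).fderiv
  have hEq : (fun x => divergence v x * U.indicator (fun _ => q K) x) = U.indicator fun _ =>
      (∑ a : Fin 3, A.linear.toContinuousLinearMap (EuclideanSpace.single a 1) a) * q K := by
    funext x
    by_cases hx : x ∈ U
    · rw [indicator_of_mem hx, indicator_of_mem hx, divergence, hfd x hx]
    · rw [indicator_of_notMem hx, indicator_of_notMem hx, mul_zero]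
  rw [hEq]
  exact ((integrable_indicator_iff isOpen_interior.measurableSet).2
    (integrableOn_const hU.ne)).restrict

theorem integral_divergence_add [Finite (wfCells T)]
    {v : EuclideanSpace ℝ (Fin 3) → EuclideanSpace ℝ (Fin 3)} (hv : v ∈ velocitySpace T)
    (p q : P0 T) : ∫ x in domain T, divergence v x * P0.toFun T (p + q) x =
      (∫ x in domain T, divergence v x * P0.toFun T p x) +
        ∫ x in domain T, divergence v x * P0.toFun T q x := by
  rw [← integral_add (integrable_divergence_mul_toFun hv p) (integrable_divergence_mul_toFun hv q)]
  simp only [P0.toFun_add, mul_add]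

theorem integral_divergence_sub [Finite (wfCells T)]
    {v : EuclideanSpace ℝ (Fin 3) → EuclideanSpace ℝ (Fin 3)} (hv : v ∈ velocitySpace T)
    (p q : P0 T) : ∫ x in domain T, divergence v x * P0.toFun T (p - q) x =
      (∫ x in domain T, divergence v x * P0.toFun T p x) -
        ∫ x in domain T, divergence v x * P0.toFun T q x := by
  rw [← integral_sub (integrable_divergence_mul_toFun hv p) (integrable_divergence_mul_toFun hv q)]
  simp only [P0.toFun_sub, mul_sub]

/-- The column operations reflect that the integrals are linear in the pressure. -/
theorem divMatrix_psi [Finite (wfCells T)] (lab : Labeling T) {N : ℕ}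
    {v : Fin N → EuclideanSpace ℝ (Fin 3) → EuclideanSpace ℝ (Fin 3)}
    (hv : ∀ k, v k ∈ velocitySpace T) :
    divMatrix T v lab.psi = deleteColumns (columnOps (divMatrix T v lab.phi)) := by
  ext k i
  rcases i with ⟨z, m⟩ | z
  · fin_cases m <;>
      simp [divMatrix, deleteColumns, columnOps, BasisLabel.toLabel, Labeling.psi,
        integral_divergence_add (hv k), integral_divergence_sub (hv k)] <;> ring
  · simp [divMatrix, deleteColumns, columnOps, BasisLabel.toLabel, Labeling.psi,
        integral_divergence_add (hv k)]
    ring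

/-! ### The column operations as elementary ones -/

/-- The split point of a label. -/
def Label.point : Label T → interiorSplitPoints T ⊕ boundarySplitPoints T
  | .inl (z, _) => .inl z
  | .inr (z, _) => .inr z

/-- The elementary column operations at one split point, as triples of a source column, a target
column and a factor. -/
def pointOps : interiorSplitPoints T ⊕ boundarySplitPoints T → List (Label T × Label T × ℝ)
  | .inl z => [(.inl (z, 0), .inl (z, 2), 1), (.inl (z, 1), .inl (z, 2), 1),
      (.inl (z, 0), .inl (z, 3), 1), (.inl (z, 1), .inl (z, 4), 1),
      (.inl (z, 0), .inl (z, 5), -1), (.inl (z, 1), .inl (z, 5), -1)]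
  | .inr z => [(.inr (z, 0), .inr (z, 2), 1), (.inr (z, 1), .inr (z, 2), 1)]

theorem pointOps_ne (p : interiorSplitPoints T ⊕ boundarySplitPoints T) :
    ∀ s ∈ pointOps p, s.1 ≠ s.2.1 := by
  rcases p with z | z <;> simp [pointOps]

open scoped Classical in
theorem foldl_pointOps (p : interiorSplitPoints T ⊕ boundarySplitPoints T) {N : ℕ}
    (B : Matrix (Fin N) (Label T) ℝ) :
    (pointOps p).foldl (fun C s => addColumn C s.1 s.2.1 s.2.2) B =
      Matrix.of fun k c => if c.point = p then columnOps B k c else B k c := by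
  ext k c
  rcases p with z | z <;> rcases c with ⟨z', j⟩ | ⟨z', j⟩
  · by_cases hz : z' = z
    · subst hz
      fin_cases j <;>
        simp [pointOps, addColumn, columnOps, Label.point, sub_eq_add_neg]
    · simp [pointOps, addColumn, Label.point, hz]
  · simp [pointOps, addColumn, Label.point]
  · simp [pointOps, addColumn, Label.point]
  · by_cases hz : z' = z
    · subst hz
      fin_cases j <;> simp [pointOps, addColumn, columnOps, Label.point]
    · simp [pointOps, addColumn, Label.point, hz]

/-- The operations at a split point only involve the columns of that split point. -/
theorem columnOps_congr {N : ℕ} {B C : Matrix (Fin N) (Label T) ℝ} (k : Fin N) (c : Label T)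
    (h : ∀ d : Label T, d.point = c.point → B k d = C k d) :
    columnOps B k c = columnOps C k c := by
  rcases c with ⟨z, j⟩ | ⟨z, j⟩
  · have h' : ∀ i, B k (.inl (z, i)) = C k (.inl (z, i)) := fun i => h _ rfl
    simp only [columnOps, Matrix.of_apply, h']
  · have h' : ∀ i, B k (.inr (z, i)) = C k (.inr (z, i)) := fun i => h _ rfl
    simp only [columnOps, Matrix.of_apply, h']

theorem exists_elementary_columnOps (hT : IsTetrahedral T) :
    ∃ L : List (Label T × Label T × ℝ), (∀ s ∈ L, s.1 ≠ s.2.1) ∧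
      ∀ (N : ℕ) (B : Matrix (Fin N) (Label T) ℝ),
        columnOps B = L.foldl (fun C s => addColumn C s.1 s.2.1 s.2.2) B := by
  classical
  have := finite_interiorSplitPoints hT
  have := finite_boundarySplitPoints hT
  have := Fintype.ofFinite (interiorSplitPoints T ⊕ boundarySplitPoints T)
  have key : ∀ P : Finset (interiorSplitPoints T ⊕ boundarySplitPoints T),
      ∃ L : List (Label T × Label T × ℝ), (∀ s ∈ L, s.1 ≠ s.2.1) ∧
        ∀ (N : ℕ) (B : Matrix (Fin N) (Label T) ℝ),
          L.foldl (fun C s => addColumn C s.1 s.2.1 s.2.2) B =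
            Matrix.of fun k c => if c.point ∈ P then columnOps B k c else B k c := by
    intro P
    induction P using Finset.induction_on with
    | empty => exact ⟨[], by simp, fun N B => by ext; simp⟩
    | insert p P hp ih =>
      obtain ⟨L, hL, hLB⟩ := ih
      refine ⟨L ++ pointOps p, fun s hs => ?_, fun N B => ?_⟩
      · rcases List.mem_append.1 hs with hs | hs
        exacts [hL s hs, pointOps_ne p s hs]
      · rw [List.foldl_append, hLB, foldl_pointOps]
        ext k c
        simp only [Matrix.of_apply, Finset.mem_insert]
        by_cases hc : c.point = p
        · rw [if_pos hc, if_pos (.inl hc)]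
          refine columnOps_congr k c fun d hd => ?_
          rw [Matrix.of_apply, if_neg (by rwa [hd, hc])]
        · simp only [hc, if_false, false_or]
  obtain ⟨L, hL, hLB⟩ := key Finset.univ
  refine ⟨L, hL, fun N B => ?_⟩
  rw [hLB]
  ext k c
  simp

end WorseyFarin

end

open WorseyFarin in
theorem mainTheorem3 (T : Geometry.SimplicialComplex ℝ (EuclideanSpace ℝ (Fin 3)))
    (hT : IsTetrahedral T) :
    Nonempty (Labeling T) ∧
    ∀ lab : Labeling T,
      -- every tetrahedron of the Worsey-Farin triangulation has exactly one label
      Function.Bijective lab.cell ∧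
      -- the functions `ψ` form a basis of the pressure space
      (∃ b : Module.Basis (BasisLabel T) ℝ (pressureSpace T), ∀ i, (b i : P0 T) = lab.psi i) ∧
      -- the Stokes matrix of the constrained pair comes from that of the unconstrained pair
      -- by column operations and the deletion of columns
      (∀ (ν : ℝ) (N : ℕ) (φ : Module.Basis (Fin N) ℝ (velocitySpace T)),
        stokesMatrix T ν (fun k => (φ k).1) lab.psi =
          let A := (stokesMatrix T ν (fun k => (φ k).1) lab.phi).toBlocks₁₁
          let B := deleteColumns
            (columnOps (stokesMatrix T ν (fun k => (φ k).1) lab.phi).toBlocks₁₂)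
          Matrix.fromBlocks A B B.transpose 0) ∧
      -- the column operations are a finite sequence of elementary ones
      (∃ L : List (Label T × Label T × ℝ), (∀ s ∈ L, s.1 ≠ s.2.1) ∧
        ∀ (N : ℕ) (B : Matrix (Fin N) (Label T) ℝ),
          columnOps B = L.foldl (fun C s => addColumn C s.1 s.2.1 s.2.2) B) := by
  refine ⟨nonempty_labeling, fun lab => ⟨lab.cell_bijective, lab.exists_basis hT,
    fun ν N φ => ?_, exists_elementary_columnOps hT⟩⟩
  have := finite_wfCells lab hT
  simp only [stokesMatrix, Matrix.toBlocks_fromBlocks₁₁, Matrix.toBlocks_fromBlocks₁₂,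
    divMatrix_psi lab fun k => (φ k).2]
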